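/- Let $\mathbb{Y}$ be a locally compact Hausdorff space with a countable base, with its Borel $\sigma$-field, and let $\mathcal{F}$ be the set of all closed subsets of $\mathbb{Y}$, with the Borel $\sigma$-field of the Fell topology (generated by the sets $\{F : F\cap C=\emptyset\}$, $C$ compact, and $\{F : F\cap G\neq\emptyset\}$, $G$ open). Let $\rho$ be a Borel measure on $\mathbb{Y}$ and let $\mathcal{F}'\subset\mathcal{F}$ be a measurable set, closed under finite unions, such that $\rho(K)<\infty$ for all $K\in\mathcal{F}'$ and $K\mapsto\rho(K)$ is measurable on $\mathcal{F}'$. Let $\Lambda$ be a $\sigma$-finite measure on $\mathcal{F}'$ with $\int\rho(K)\,\Lambda(dK)<\infty$, and assume that $$s_0:=\sup\Big\{s>0:\int\mathbf{1}\{\rho(K)>1\}e^{s\rho(K)}\,\Lambda(dK)<\infty\Big\}$$ is positive (the value $s_0=\infty$ is allowed, and $\sup\emptyset:=0$). Let $\eta$ be a Poisson process on $\mathcal{F}'$ with intensity measure $\Lambda$, that is, a random $\sigma$-finite measure with values in $\{0,1,2,\dots,\infty\}$ such that $\eta(B)$ is Poisson distributed with parameter $\Lambda(B)$ for each measurable $B\subset\mathcal{F}'$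 (with $\eta(B)=\infty$ almost surely if $\Lambda(B)=\infty$) and such that $\eta(B_1),\dots,\eta(B_m)$ are independent for pairwise disjoint measurable $B_1,\dots,B_m$. Fix measurable sets $B_n\uparrow\mathcal{F}'$ with $\Lambda(B_n)<\infty$ for all $n$. Let $Z$ be the Boolean model $$Z:=\bigcup_{K:\,\eta(\{K\})>0}K$$ on the event (of probability one) that $\eta(B_n)<\infty$ for all $n$, and $Z:=\emptyset$ otherwise. Let $F:=\rho(Z)$ if $\rho(Z)<\infty$ and $F:=0$ otherwise. Put $\tau(z):=(1-e^{-z})/z$ for $0<z<\infty$, $\tau(0):=1$, $\tau(\infty):=0$, and $$\rho^*(K):=\int_K\tau\big(\Lambda(\{L\in\mathcal{F}':y\in L\})\big)\,\rho(dy),\qquad \nu^*:=\int_{\mathcal{F}'}\mathbf{1}\{\rho(K)\in\cdot\}\,\frac{\rho^*(K)}{\rho(K)}\,\Lambda(dK),$$ where $0/0:=0$, so that $\nu^*$ is a measure on $[0,\infty)$. For $s,u\ge 0$ let $$h(s):=\int u\,(e^{su}-1)\,\nu^*(du)\in[0,\infty],\qquad h^{-1}(u):=\inf\{s\ge 0:h(s)\ge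 u\},\quad \inf\emptyset:=\infty,$$ and let $h(s_0-):=\lim_{s\uparrow s_0}h(s)$. Then $F$ is integrable and $$\mathbb{P}(F-\mathbb{E}[F]\ge r)\le\exp\Big(-\int_0^r h^{-1}(u)\,du\Big),\qquad r\in(0,h(s_0-)).$$ -/

import Mathlib

open MeasureTheory ProbabilityTheory TopologicalSpace
open scoped ENNReal NNReal

namespace BooleanModel

noncomputable section

/-! ### Closed sets with the Fell topology -/

/-- The Fell topology on the closed subsets of `Y`, generated by the sets
`{F | F ∩ C = ∅}` (`C` compact) and `{F | F ∩ G ≠ ∅}` (`G` open). -/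
abbrev fellTopology (Y : Type*) [TopologicalSpace Y] : TopologicalSpace (Closeds Y) :=
  TopologicalSpace.generateFrom
    ({U | ∃ C : Set Y, IsCompact C ∧ U = {F : Closeds Y | (F : Set Y) ∩ C = ∅}} ∪
      {U | ∃ G : Set Y, IsOpen G ∧ U = {F : Closeds Y | ((F : Set Y) ∩ G).Nonempty}})

/-- The Borel σ-field of the Fell topology. -/
instance instMeasurableSpaceCloseds (Y : Type*) [TopologicalSpace Y] :
    MeasurableSpace (Closeds Y) :=
  @borel (Closeds Y) (fellTopology Y)

/-! ### Poisson processes -/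

/-- The Poisson distribution on `[0, ∞]` with parameter `c ∈ [0, ∞]`; for `c = ∞` it is the
point mass at `∞`. -/
def poissonLaw (c : ℝ≥0∞) : Measure ℝ≥0∞ :=
  if c = ∞ then Measure.dirac ∞
  else (poissonMeasure c.toNNReal).map (fun n : ℕ => (n : ℝ≥0∞))

/-- Membership in the space `N(X)`: σ-finite measures with values in `{0, 1, 2, …, ∞}`. -/
def IsCountingMeasure {X : Type*} [MeasurableSpace X] (μ : Measure X) : Prop :=
  SigmaFinite μ ∧ ∀ B : Set X, MeasurableSet B → ∃ n : ℕ∞, μ B = (n : ℝ≥0∞)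

/-- `η` is a Poisson process on `X` with intensity measure `Λ`, defined over `(Ω, P)`.
The σ-field on measures is generated by the evaluations `μ ↦ μ B`, `B` measurable. -/
structure IsPoissonProcess {Ω X : Type*} [MeasurableSpace Ω] [MeasurableSpace X]
    (P : Measure Ω) (Λ : Measure X) (η : Ω → Measure X) : Prop where
  measurable : Measurable η
  counting : ∀ ω, IsCountingMeasure (η ω)
  law : ∀ B : Set X, MeasurableSet B → P.map (fun ω => η ω B) = poissonLaw (Λ B)
  indep : ∀ (m : ℕ) (B : Fin m → Set X), (∀ i, MeasurableSet (B i)) →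
    Pairwise (fun i j => Disjoint (B i) (B j)) → iIndepFun (fun i ω => η ω (B i)) P

/-! ### The Boolean model and its `ρ`-content -/

section Model

variable {Y : Type*} [TopologicalSpace Y] {𝓕 : Set (Closeds Y)}

/-- `Z(μ)`: the union of all particles `K` (that is, `μ {K} > 0`) if `μ` is finite on every set
`B n` of the exhausting sequence, and the empty set otherwise. -/
def grainUnion (B : ℕ → Set 𝓕) (μ : Measure 𝓕) : Set Y :=
  {y | (∀ n, μ (B n) < ∞) ∧ ∃ K : 𝓕, 0 < μ {K} ∧ y ∈ (K : Closeds Y)}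

variable [MeasurableSpace Y]

/-- The value `ρ(K)` of a grain. -/
def content (ρ : Measure Y) (K : 𝓕) : ℝ≥0∞ := ρ ((K : Closeds Y) : Set Y)

/-- `f(μ) = 1{ρ(Z(μ)) < ∞} ρ(Z(μ))` (note that `(∞ : ℝ≥0∞).toReal = 0`). -/
def coveredContent (ρ : Measure Y) (B : ℕ → Set 𝓕) (μ : Measure 𝓕) : ℝ :=
  (ρ (grainUnion B μ)).toReal

/-! ### The measure `ν*`, the constant `s₀` and the function `h` -/

/-- `τ(z) = (1 - e^{-z}) / z` for `0 < z < ∞`, with `τ(0) = 1` and `τ(∞) = 0`. -/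
def tau (z : ℝ≥0∞) : ℝ≥0∞ :=
  if z = 0 then 1
  else if z = ∞ then 0
  else ENNReal.ofReal ((1 - Real.exp (-z.toReal)) / z.toReal)

/-- `ρ*(K) = ∫_K τ(Λ{L : y ∈ L}) ρ(dy)`. -/
def rhoStar (ρ : Measure Y) (Λ : Measure 𝓕) (K : 𝓕) : ℝ≥0∞ :=
  ∫⁻ y in ((K : Closeds Y) : Set Y), tau (Λ {L : 𝓕 | y ∈ (L : Closeds Y)}) ∂ρ

/-- `ν* = ∫ 1{ρ(K) ∈ ·} (ρ*(K) / ρ(K)) Λ(dK)`, a measure on `[0, ∞)`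
(in `ℝ≥0∞` one has `0 / 0 = 0`). -/
def nuStar (ρ : Measure Y) (Λ : Measure 𝓕) : Measure ℝ≥0 :=
  (Λ.withDensity (fun K => rhoStar ρ Λ K / content ρ K)).map
    (fun K => (content ρ K).toNNReal)

/-- `s₀ = sup {s > 0 : ∫ 1{ρ(K) > 1} e^{s ρ(K)} Λ(dK) < ∞} ∈ [0, ∞]`. -/
def sZero (ρ : Measure Y) (Λ : Measure 𝓕) : ℝ≥0∞ :=
  sSup ((fun s : ℝ≥0 => (s : ℝ≥0∞)) '' {s : ℝ≥0 | 0 < s ∧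
    ∫⁻ K in {K : 𝓕 | 1 < content ρ K},
      ENNReal.ofReal (Real.exp (s * (content ρ K).toReal)) ∂Λ < ∞})

/-- `h(s) = ∫ u (e^{su} - 1) ν*(du) ∈ [0, ∞]`, `s ≥ 0`. -/
def hFun (ρ : Measure Y) (Λ : Measure 𝓕) (s : ℝ≥0) : ℝ≥0∞ :=
  ∫⁻ u : ℝ≥0, ENNReal.ofReal (u * (Real.exp (s * u) - 1)) ∂(nuStar ρ Λ)

end Model

/-- The generalized inverse `u ↦ inf {s ≥ 0 : g(s) ≥ u}`, with `inf ∅ = ∞`. -/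
def genInv (g : ℝ≥0 → ℝ≥0∞) (u : ℝ≥0∞) : ℝ≥0∞ :=
  sInf ((fun s : ℝ≥0 => (s : ℝ≥0∞)) '' {s : ℝ≥0 | u ≤ g s})

/-- The left limit `g(a-)` of a nondecreasing function `g` on `[0, ∞)` at `a ∈ (0, ∞]`,
see `tendsto_leftLimit`. -/
def leftLimit (g : ℝ≥0 → ℝ≥0∞) (a : ℝ≥0∞) : ℝ≥0∞ :=
  ⨆ (s : ℝ≥0) (_ : (s : ℝ≥0∞) < a), g s

theorem tendsto_leftLimit {g : ℝ≥0 → ℝ≥0∞} (hg : Monotone g) (a : ℝ≥0∞) :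
    Filter.Tendsto g (Filter.comap (fun s : ℝ≥0 => (s : ℝ≥0∞)) (nhdsWithin a (Set.Iio a)))
      (nhds (leftLimit g a)) := by
  refine tendsto_order.2 ⟨fun b hb => ?_, fun b hb => ?_⟩
  · obtain ⟨s, hs⟩ := lt_iSup_iff.1 hb
    obtain ⟨hsa, hs⟩ := lt_iSup_iff.1 hs
    refine Filter.mem_of_superset (Filter.preimage_mem_comap
      (mem_nhdsWithin_of_mem_nhds (lt_mem_nhds hsa))) fun t ht => ?_
    exact hs.trans_le (hg (le_of_lt (by simpa using ht)))
  · refine Filter.mem_of_superset (Filter.preimage_mem_comap self_mem_nhdsWithin)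
      fun t ht => ?_
    exact lt_of_le_of_lt (le_iSup₂_of_le (f := fun (s : ℝ≥0) (_ : (s : ℝ≥0∞) < a) => g s)
      t ht le_rfl) hb

theorem hFun_mono {Y : Type*} [TopologicalSpace Y] [MeasurableSpace Y] {𝓕 : Set (Closeds Y)}
    (ρ : Measure Y) (Λ : Measure 𝓕) : Monotone (hFun ρ Λ) := by
  intro s t hst
  refine lintegral_mono fun u => ENNReal.ofReal_le_ofReal ?_
  have : (s : ℝ) ≤ t := hst
  gcongr

end

end BooleanModel

/-! The proof is a Chernoff bound whose exponential moment is controlled by differentiating in the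
intensity. Take Λ finite first, and let Z_a be the union of the grains of a Poisson process with
intensity aΛ, 0 ≤ a ≤ 1. Then d/da E f(Z_a) = E ∫ (f(Z_a ∪ K) - f(Z_a)) Λ(dK)
(`HasGeometricMoments.hasDerivAt`). Put u(a) = E e^{sρ(Z_a)} and m(a) = E ρ(Z_a). Adding K increases
ρ(Z) by x = ρ(K \ Z) ≤ ρ(K), and convexity gives e^{sx} - 1 ≤ x ((e^{sρ(K)} - 1 - sρ(K))/ρ(K) + s).
Since e^{sρ(Z)} increases with Z while 1{y ∉ Z} decreases, a Harris inequality
(`setLIntegral_missSet_le`) bounds E[e^{sρ(Z_a)} ρ(K \ Z_a)] by u(a) E ρ(K \ Z_a). The linear part s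
contributes exactly s m'(a), so the derivative of log u - s m is at most ∫ (e^{sρ(K)} - 1 -
sρ(K))/ρ(K) · E ρ(K \ Z_a) Λ(dK).

Integrating over a in (0,1] turns E ρ(K \ Z_a) into ρ*(K), because P(y ∉ Z_a) = e^{-aΛ{L : y ∈ L}}
and ∫_0^1 e^{-az} da = τ(z). This gives log E e^{s(F - E F)} ≤ ∫ (e^{sρ} - 1 - sρ) ρ*/ρ dΛ = ∫_0^s
h(v) dv (`IsGrainClass.lintegral_expContent_poissonUnion_le`, `lintegral_hFun`). The σ-finite case
follows by exhaustion along B_n (`IsPoissonProcess.lintegral_exp_totalContent_le`). Young's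
inequality ∫_0^r h^{-1} + ∫_0^s h ≤ sr at s = h^{-1}(r) (`lintegral_genInv_add_le`) then yields the
tail bound.

Laws of random closed sets are compared through void probabilities: the events of missing a compact
set form a π-system that generates the σ-field (`measure_ext_of_missSet`). -/

namespace BooleanModel

noncomputable section

/-! ### Measurability for the Fell topology -/

section Fell

variable {Y : Type*} [TopologicalSpace Y]

/-- The closed sets that do not meet `C`. -/
def missSet (C : Set Y) : Set (Closeds Y) := {F | (F : Set Y) ∩ C = ∅}

theorem mem_missSet {C : Set Y} {K : Closeds Y} : K ∈ missSet C ↔ (K : Set Y) ∩ C = ∅ := Iff.rfl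

theorem mem_missSet_singleton {y : Y} {K : Closeds Y} : K ∈ missSet {y} ↔ y ∉ K := by
  simp [mem_missSet, Set.inter_singleton_eq_empty]

theorem sup_mem_missSet {C : Set Y} {K L : Closeds Y} :
    K ⊔ L ∈ missSet C ↔ K ∈ missSet C ∧ L ∈ missSet C := by
  simp [mem_missSet, Closeds.coe_sup, Set.union_inter_distrib_right]

theorem bot_mem_missSet (C : Set Y) : (⊥ : Closeds Y) ∈ missSet C := by
  simp [mem_missSet]

theorem missSet_inter (C D : Set Y) : missSet C ∩ missSet D = missSet (C ∪ D) := by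
  ext K
  simp [mem_missSet, Set.inter_union_distrib_left]

theorem measurableSet_missSet {C : Set Y} (hC : IsCompact C) : MeasurableSet (missSet C) := by
  let := fellTopology Y
  refine MeasurableSpace.measurableSet_generateFrom ?_
  exact isOpen_generateFrom_of_mem (Or.inl ⟨C, hC, rfl⟩)

/-- Finite unions of compact closures of members of the standard countable basis. -/
def compactCells (Y : Type*) [TopologicalSpace Y] [SecondCountableTopology Y] : Set (Set Y) :=
  {D | ∃ s : Set (Set Y), (s.Finite ∧ s ⊆ {C | IsCompact C ∧ ∃ U ∈ countableBasis Y,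
    C = closure U}) ∧ D = ⋃₀ s}

theorem countable_compactCells (Y : Type*) [TopologicalSpace Y] [SecondCountableTopology Y] :
    (compactCells Y).Countable := by
  have h : {C : Set Y | IsCompact C ∧ ∃ U ∈ countableBasis Y, C = closure U}.Countable := by
    refine ((countable_countableBasis Y).image closure).mono ?_
    rintro C ⟨-, U, hU, rfl⟩
    exact ⟨U, hU, rfl⟩
  refine ((Set.countable_ofPred_finite_subset h).image Set.sUnion).mono ?_
  rintro D ⟨s, hs, rfl⟩
  exact ⟨s, hs, rfl⟩

theorem isCompact_of_mem_compactCells [SecondCountableTopology Y] {D : Set Y}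
    (hD : D ∈ compactCells Y) : IsCompact D := by
  obtain ⟨s, ⟨hs, hs'⟩, rfl⟩ := hD
  exact hs.isCompact_sUnion fun C hC => (hs' hC).1

variable [T2Space Y] [LocallyCompactSpace Y] [SecondCountableTopology Y]

theorem exists_compactCell_nhds {y : Y} {G : Set Y} (hG : IsOpen G) (hy : y ∈ G) :
    ∃ U ∈ countableBasis Y, y ∈ U ∧ closure U ∈ compactCells Y ∧ closure U ⊆ G := by
  obtain ⟨K, hK, hyK, hKG⟩ := exists_compact_subset hG hy
  obtain ⟨U, hU, hyU, hUK⟩ :=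
    (isBasis_countableBasis Y).exists_subset_of_mem_open hyK isOpen_interior
  have h : closure U ⊆ K := closure_minimal (hUK.trans interior_subset) hK.isClosed
  refine ⟨U, hU, hyU, ⟨{closure U}, ⟨Set.finite_singleton _, ?_⟩, by simp⟩, h.trans hKG⟩
  rintro _ rfl
  exact ⟨hK.of_isClosed_subset isClosed_closure h, U, hU, rfl⟩

theorem exists_compactCell_between {C G : Set Y} (hC : IsCompact C) (hG : IsOpen G)
    (hCG : C ⊆ G) : ∃ D ∈ compactCells Y, C ⊆ D ∧ D ⊆ G := by
  refine hC.induction_on (p := fun s => ∃ D ∈ compactCells Y, s ⊆ D ∧ D ⊆ G) ?_ ?_ ?_ ?_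
  · exact ⟨∅, ⟨∅, by simp, by simp⟩, by simp, by simp⟩
  · rintro s t hst ⟨D, hD, h1, h2⟩
    exact ⟨D, hD, hst.trans h1, h2⟩
  · rintro s t ⟨D, ⟨a, ⟨ha, ha'⟩, rfl⟩, h1, h2⟩ ⟨E, ⟨b, ⟨hb, hb'⟩, rfl⟩, h3, h4⟩
    refine ⟨⋃₀ (a ∪ b), ⟨_, ⟨ha.union hb, Set.union_subset ha' hb'⟩, rfl⟩, ?_, ?_⟩
    · rw [Set.sUnion_union]; exact Set.union_subset_union h1 h3
    · rw [Set.sUnion_union]; exact Set.union_subset h2 h4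
  · intro y hy
    obtain ⟨U, hU, hyU, hc, hUG⟩ := exists_compactCell_nhds hG (hCG hy)
    exact ⟨U, mem_nhdsWithin_of_mem_nhds
      (((isBasis_countableBasis Y).isOpen hU).mem_nhds hyU), _, hc, subset_closure, hUG⟩

/-- A closed set missing a compact C misses a whole compact cell around C, and an open set is hit
exactly when one of the basic open sets inside it is hit. Hence countably many subbasic sets
suffice. This makes the Borel σ-field the one generated by the subbasis. -/
theorem secondCountable_fellTopology (Y : Type*) [TopologicalSpace Y] [T2Space Y]
    [LocallyCompactSpace Y] [SecondCountableTopology Y] :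
    @SecondCountableTopology _ (fellTopology Y) := by
  let 𝒢 : Set (Set (Closeds Y)) := (missSet '' compactCells Y) ∪
    ((fun G : Set Y => {F : Closeds Y | ((F : Set Y) ∩ G).Nonempty}) '' countableBasis Y)
  have hc : 𝒢.Countable :=
    ((countable_compactCells Y).image _).union ((countable_countableBasis Y).image _)
  have heq : fellTopology Y = generateFrom 𝒢 := by
    refine le_antisymm (generateFrom_anti ?_) (le_generateFrom ?_)
    · rintro _ (⟨D, hD, rfl⟩ | ⟨U, hU, rfl⟩)
      · exact Or.inl ⟨D, isCompact_of_mem_compactCells hD, rfl⟩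
      · exact Or.inr ⟨U, (isBasis_countableBasis Y).isOpen hU, rfl⟩
    · let : TopologicalSpace (Closeds Y) := generateFrom 𝒢
      rintro _ (⟨C, hC, rfl⟩ | ⟨G, hG, rfl⟩)
      · have : {F : Closeds Y | (F : Set Y) ∩ C = ∅} =
            ⋃ D ∈ {D ∈ compactCells Y | C ⊆ D}, missSet D := by
          ext F
          simp only [Set.mem_ofPred_eq, Set.mem_iUnion, exists_prop, mem_missSet]
          constructor
          · intro h
            obtain ⟨D, hD, h1, h2⟩ := exists_compactCell_between hC F.isClosed.isOpen_compl
              (fun y hy hyF => (Set.eq_empty_iff_forall_notMem.1 h y ⟨hyF, hy⟩))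
            refine ⟨D, ⟨hD, h1⟩, Set.eq_empty_iff_forall_notMem.2 fun y hy => h2 hy.2 hy.1⟩
          · rintro ⟨D, ⟨-, h1⟩, h2⟩
            exact Set.subset_eq_empty (Set.inter_subset_inter_right _ h1) h2
        rw [this]
        exact isOpen_biUnion fun D hD =>
          isOpen_generateFrom_of_mem (Or.inl ⟨D, hD.1, rfl⟩)
      · have : {F : Closeds Y | ((F : Set Y) ∩ G).Nonempty} =
            ⋃ U ∈ {U ∈ countableBasis Y | U ⊆ G},
              {F : Closeds Y | ((F : Set Y) ∩ U).Nonempty} := by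
          ext F
          simp only [Set.mem_ofPred_eq, Set.mem_iUnion, exists_prop]
          constructor
          · rintro ⟨y, hyF, hyG⟩
            obtain ⟨U, hU, hyU, hUG⟩ :=
              (isBasis_countableBasis Y).exists_subset_of_mem_open hyG hG
            exact ⟨U, ⟨hU, hUG⟩, y, hyF, hyU⟩
          · rintro ⟨U, ⟨-, hUG⟩, y, hyF, hyU⟩
            exact ⟨y, hyF, hUG hyU⟩
        rw [this]
        exact isOpen_biUnion fun U hU =>
          isOpen_generateFrom_of_mem (Or.inr ⟨U, hU.1, rfl⟩)
  let := fellTopology Y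
  exact ⟨⟨𝒢, hc, heq⟩⟩

/-- The Borel σ-field of the Fell topology is generated by the sets `missSet C`, `C` compact. -/
theorem measurableSpace_closeds_eq (Y : Type*) [TopologicalSpace Y] [T2Space Y]
    [LocallyCompactSpace Y] [SecondCountableTopology Y] :
    instMeasurableSpaceCloseds Y =
      MeasurableSpace.generateFrom {A | ∃ C : Set Y, IsCompact C ∧ A = missSet C} := by
  let := fellTopology Y
  have := secondCountable_fellTopology Y
  refine (borel_eq_generateFrom_of_subbasis (α := Closeds Y) rfl).trans (le_antisymm ?_ ?_)
  · refine MeasurableSpace.generateFrom_le ?_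
    rintro _ (⟨C, hC, rfl⟩ | ⟨G, hG, rfl⟩)
    · exact MeasurableSpace.measurableSet_generateFrom ⟨C, hC, rfl⟩
    -- An open set is a countable union of compact cells, so hitting it is a countable union of
    -- complements of miss events.
    · have : {F : Closeds Y | ((F : Set Y) ∩ G).Nonempty} =
          ⋃ D ∈ {D ∈ compactCells Y | D ⊆ G}, (missSet D)ᶜ := by
        ext F
        simp only [Set.mem_ofPred_eq, Set.mem_iUnion, exists_prop, mem_missSet, Set.mem_compl_iff,
          ← Set.nonempty_iff_ne_empty, ← ne_eq]
        constructor
        · rintro ⟨y, hyF, hyG⟩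
          obtain ⟨U, -, hyU, hc, hUG⟩ := exists_compactCell_nhds hG hyG
          exact ⟨_, ⟨hc, hUG⟩, y, hyF, subset_closure hyU⟩
        · rintro ⟨U, ⟨-, hUG⟩, y, hyF, hyU⟩
          exact ⟨y, hyF, hUG hyU⟩
      rw [this]
      refine MeasurableSet.biUnion ((countable_compactCells Y).mono (Set.sep_subset _ _)) ?_
      intro D hD
      refine MeasurableSet.compl (MeasurableSpace.measurableSet_generateFrom ?_)
      exact ⟨D, isCompact_of_mem_compactCells hD.1, rfl⟩
  · refine MeasurableSpace.generateFrom_mono ?_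
    rintro _ ⟨C, hC, rfl⟩
    exact Or.inl ⟨C, hC, rfl⟩

theorem isPiSystem_missSet (Y : Type*) [TopologicalSpace Y] :
    IsPiSystem {A : Set (Closeds Y) | ∃ C : Set Y, IsCompact C ∧ A = missSet C} := by
  rintro _ ⟨C, hC, rfl⟩ _ ⟨D, hD, rfl⟩ -
  exact ⟨C ∪ D, hC.union hD, missSet_inter C D⟩

/-- A finite measure on the closed sets is determined by its void probabilities. -/
theorem measure_ext_of_missSet {μ ν : Measure (Closeds Y)} [IsFiniteMeasure μ]
    (h : ∀ C : Set Y, IsCompact C → μ (missSet C) = ν (missSet C)) : μ = ν := by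
  refine ext_of_generate_finite _ (measurableSpace_closeds_eq Y) (isPiSystem_missSet Y) ?_ ?_
  · rintro _ ⟨C, hC, rfl⟩
    exact h C hC
  · have : missSet (∅ : Set Y) = Set.univ := by ext; simp [mem_missSet]
    simpa [this] using h ∅ isCompact_empty

theorem measurable_of_missSet {α : Type*} [MeasurableSpace α] {f : α → Closeds Y}
    (h : ∀ C : Set Y, IsCompact C → MeasurableSet (f ⁻¹' missSet C)) : Measurable f := by
  rw [measurableSpace_closeds_eq Y]
  refine measurable_generateFrom ?_
  rintro _ ⟨C, hC, rfl⟩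
  exact h C hC

theorem measurable_sup_closeds :
    Measurable (fun p : Closeds Y × Closeds Y => p.1 ⊔ p.2) := by
  refine measurable_of_missSet fun C hC => ?_
  have : (fun p : Closeds Y × Closeds Y => p.1 ⊔ p.2) ⁻¹' missSet C =
      missSet C ×ˢ missSet C := by
    ext p
    exact sup_mem_missSet
  rw [this]
  exact (measurableSet_missSet hC).prod (measurableSet_missSet hC)

/-- If y ∉ K, some basic neighbourhood of y has compact closure missing K, so the complement is a
countable union of rectangles. This joint measurability permits Fubini over points and random sets.
-/
theorem measurableSet_mem_closeds [MeasurableSpace Y] [BorelSpace Y] :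
    MeasurableSet {p : Y × Closeds Y | p.1 ∈ p.2} := by
  have : {p : Y × Closeds Y | p.1 ∈ p.2}ᶜ =
      ⋃ U ∈ {U ∈ countableBasis Y | closure U ∈ compactCells Y}, U ×ˢ missSet (closure U) := by
    ext ⟨y, K⟩
    simp only [Set.mem_compl_iff, Set.mem_ofPred_eq, Set.mem_iUnion, Set.mem_prod, exists_prop,
      mem_missSet]
    constructor
    · intro h
      obtain ⟨U, hU, hyU, hc, hUG⟩ := exists_compactCell_nhds K.isClosed.isOpen_compl h
      exact ⟨U, ⟨hU, hc⟩, hyU, Set.eq_empty_iff_forall_notMem.2 fun z hz => hUG hz.2 hz.1⟩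
    · rintro ⟨U, -, hyU, h⟩ hy
      exact Set.eq_empty_iff_forall_notMem.1 h y ⟨hy, subset_closure hyU⟩
  rw [← MeasurableSet.compl_iff, this]
  refine MeasurableSet.biUnion ((countable_countableBasis Y).mono (Set.sep_subset _ _)) ?_
  intro U hU
  exact ((isBasis_countableBasis Y).isOpen hU.1).measurableSet.prod
    (measurableSet_missSet (isCompact_of_mem_compactCells hU.2))

instance : MeasurableSpace.CountablySeparated (Closeds Y) := by
  refine ⟨⟨missSet '' compactCells Y, (countable_compactCells Y).image _, ?_, ?_⟩⟩
  · rintro _ ⟨D, hD, rfl⟩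
    exact measurableSet_missSet (isCompact_of_mem_compactCells hD)
  · have key : ∀ K L : Closeds Y, (∀ D ∈ compactCells Y, L ∈ missSet D → K ∈ missSet D) →
        K ≤ L := by
      intro K L h y hy
      by_contra hyL
      obtain ⟨U, -, hyU, hc, hUG⟩ := exists_compactCell_nhds L.isClosed.isOpen_compl hyL
      have := h _ hc (Set.eq_empty_iff_forall_notMem.2 fun z hz => hUG hz.2 hz.1)
      exact Set.eq_empty_iff_forall_notMem.1 this y ⟨hy, subset_closure hyU⟩
    intro K _ L _ h
    refine le_antisymm (key K L fun D hD => (h _ ⟨D, hD, rfl⟩).2)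
      (key L K fun D hD => (h _ ⟨D, hD, rfl⟩).1)

instance : MeasurableSingletonClass (Closeds Y) :=
  MeasurableSpace.measurableSingletonClass_of_countablySeparated

instance (𝓕 : Set (Closeds Y)) : MeasurableSpace.CountablySeparated 𝓕 :=
  MeasurableSpace.Subtype.countablySeparated

instance (𝓕 : Set (Closeds Y)) : MeasurableSingletonClass 𝓕 :=
  MeasurableSpace.measurableSingletonClass_of_countablySeparated

end Fell

/-! ### Atoms of integer-valued measures -/

theorem exists_singleton_pos_of_integer_valued {X : Type*} [MeasurableSpace X]
    [MeasurableSpace.CountablySeparated X] {μ : Measure X} {A : Set X} (hA : MeasurableSet A)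
    (hμ : ∀ B : Set X, MeasurableSet B → B ⊆ A → ∃ n : ℕ, μ B = n) (hpos : 0 < μ A) :
    ∃ x ∈ A, 0 < μ {x} := by
  classical
  -- A subset T of least positive mass cannot be split into two parts of positive mass.
  let p : ℕ → Prop := fun n => 0 < n ∧ ∃ B, MeasurableSet B ∧ B ⊆ A ∧ μ B = n
  have hp : ∃ n, p n := by
    obtain ⟨n, hn⟩ := hμ A hA subset_rfl
    refine ⟨n, ?_, A, hA, subset_rfl, hn⟩
    rw [hn] at hpos
    exact_mod_cast hpos
  obtain ⟨hm, T, hT, hTA, hTm⟩ := Nat.find_spec hp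
  set m := Nat.find hp
  have hsplit : ∀ S : Set X, MeasurableSet S → μ (T ∩ S) = 0 ∨ μ (T \ S) = 0 := by
    intro S hS
    by_contra! hcon
    obtain ⟨a, ha⟩ := hμ (T ∩ S) (hT.inter hS) (Set.inter_subset_left.trans hTA)
    obtain ⟨b, hb⟩ := hμ (T \ S) (hT.diff hS) (Set.sdiff_subset.trans hTA)
    have ha0 : 0 < a := Nat.pos_of_ne_zero fun h => hcon.1 (by simp [ha, h])
    have hb0 : 0 < b := Nat.pos_of_ne_zero fun h => hcon.2 (by simp [hb, h])
    have h1 : m ≤ a := Nat.find_min' hp ⟨ha0, _, hT.inter hS, Set.inter_subset_left.trans hTA, ha⟩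
    have h2 : m ≤ b := Nat.find_min' hp ⟨hb0, _, hT.diff hS, Set.sdiff_subset.trans hTA, hb⟩
    have h3 : (a : ℝ≥0∞) + b = m := by rw [← ha, ← hb, ← hTm, measure_inter_add_sdiff _ hS]
    have h4 : a + b = m := by exact_mod_cast h3
    omega
  obtain ⟨𝒮, hc, hmeas, hsep⟩ :=
    (MeasurableSpace.CountablySeparated.countably_separated (α := X)).exists_countable_separating
  -- For each S of a countable separating family, discard the null one of T ∩ S and T \ S. What
  -- remains has positive mass and no two of its points are separated, so it is a single point.
  let N : Set X := ⋃ S ∈ 𝒮, (if μ (T ∩ S) = 0 then T ∩ S else T \ S)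
  have hN : μ N = 0 := by
    refine (measure_biUnion_null_iff hc).2 fun S hS => ?_
    split_ifs with h
    · exact h
    · exact (hsplit S (hmeas S hS)).resolve_left h
  have hTN : 0 < μ (T \ N) := by
    rw [measure_sdiff_null hN, hTm]
    exact_mod_cast hm
  obtain ⟨x, hx⟩ := nonempty_of_measure_ne_zero hTN.ne'
  refine ⟨x, hTA hx.1, hTN.trans_le (measure_mono ?_)⟩
  intro z hz
  refine hsep z (Set.mem_univ _) x (Set.mem_univ _) fun S hS => ?_
  have hz' : z ∉ (if μ (T ∩ S) = 0 then T ∩ S else T \ S) := fun h =>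
    hz.2 (Set.mem_biUnion hS h)
  have hx' : x ∉ (if μ (T ∩ S) = 0 then T ∩ S else T \ S) := fun h =>
    hx.2 (Set.mem_biUnion hS h)
  have hzT := hz.1
  have hxT := hx.1
  split_ifs at hz' hx' <;> simp_all

/-! ### The law of the union of a Poisson number of grains -/

section PoissonUnion

variable {Y : Type*} [TopologicalSpace Y]

/-- The (unnormalised) law of the union of `k` independent grains with distribution `Λ`. -/
def unionPow (Λ : Measure (Closeds Y)) : ℕ → Measure (Closeds Y)
  | 0 => Measure.dirac ⊥
  | k + 1 => ((unionPow Λ k).prod Λ).map (fun p => p.1 ⊔ p.2)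

instance (Λ : Measure (Closeds Y)) [IsFiniteMeasure Λ] (k : ℕ) :
    IsFiniteMeasure (unionPow Λ k) := by
  induction k with
  | zero => unfold unionPow; infer_instance
  | succ k ih => unfold unionPow; infer_instance

/-- The law of the union of the particles of a Poisson process with finite intensity
measure `a • Λ`. -/
def poissonUnion (Λ : Measure (Closeds Y)) (a : ℝ) : Measure (Closeds Y) :=
  Measure.sum fun k : ℕ =>
    ENNReal.ofReal (Real.exp (-(a * Λ.real Set.univ)) * (a ^ k / k.factorial)) • unionPow Λ k

theorem lintegral_poissonUnion (Λ : Measure (Closeds Y)) (a : ℝ) (f : Closeds Y → ℝ≥0∞) :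
    ∫⁻ Z, f Z ∂(poissonUnion Λ a) = ∑' k : ℕ,
      ENNReal.ofReal (Real.exp (-(a * Λ.real Set.univ)) * (a ^ k / k.factorial)) *
        ∫⁻ Z, f Z ∂(unionPow Λ k) := by
  simp [poissonUnion, lintegral_sum_measure, lintegral_smul_measure]

variable [T2Space Y] [LocallyCompactSpace Y] [SecondCountableTopology Y]

theorem lintegral_unionPow_succ (Λ : Measure (Closeds Y)) [IsFiniteMeasure Λ] (k : ℕ)
    {f : Closeds Y → ℝ≥0∞} (hf : Measurable f) :
    ∫⁻ Z, f Z ∂(unionPow Λ (k + 1)) = ∫⁻ Z, ∫⁻ K, f (Z ⊔ K) ∂Λ ∂(unionPow Λ k) := by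
  rw [unionPow, lintegral_map hf measurable_sup_closeds, lintegral_prod]
  exact (hf.comp measurable_sup_closeds).aemeasurable

theorem unionPow_missSet (Λ : Measure (Closeds Y)) [IsFiniteMeasure Λ] (k : ℕ) {C : Set Y}
    (hC : IsCompact C) : unionPow Λ k (missSet C) = Λ (missSet C) ^ k := by
  induction k with
  | zero => simp [unionPow, Measure.dirac_apply' _ (measurableSet_missSet hC), bot_mem_missSet]
  | succ k ih =>
    have : (fun p : Closeds Y × Closeds Y => p.1 ⊔ p.2) ⁻¹' missSet C =
        missSet C ×ˢ missSet C := by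
      ext p
      exact sup_mem_missSet
    rw [unionPow, Measure.map_apply measurable_sup_closeds (measurableSet_missSet hC), this,
      Measure.prod_prod, ih, pow_succ]

theorem tsum_ofReal_pow_div_factorial {x : ℝ} (hx : 0 ≤ x) (c : ℝ) (hc : 0 ≤ c) :
    ∑' k : ℕ, ENNReal.ofReal (c * (x ^ k / k.factorial)) = ENNReal.ofReal (c * Real.exp x) := by
  rw [← ENNReal.ofReal_tsum_of_nonneg (fun k => by positivity)
    ((Real.summable_pow_div_factorial x).mul_left c), tsum_mul_left, Real.exp_eq_exp_ℝ,
    NormedSpace.exp_eq_tsum_div]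

/-- All k grains miss C with mass Λ(miss C)^k, so the Poisson weights sum to an exponential series.
The case C = ∅ shows that the total mass is 1. -/
theorem poissonUnion_missSet (Λ : Measure (Closeds Y)) [IsFiniteMeasure Λ] {a : ℝ} (ha : 0 ≤ a)
    {C : Set Y} (hC : IsCompact C) :
    poissonUnion Λ a (missSet C) = ENNReal.ofReal (Real.exp (-(a * Λ.real (missSet C)ᶜ))) := by
  have hm := measurableSet_missSet hC
  have h1 : Λ.real (missSet C)ᶜ = Λ.real Set.univ - Λ.real (missSet C) := by
    rw [measureReal_compl hm]
  rw [poissonUnion, Measure.sum_apply _ hm]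
  simp only [Measure.smul_apply, smul_eq_mul, unionPow_missSet Λ _ hC]
  have h2 : ∀ k : ℕ, ENNReal.ofReal (Real.exp (-(a * Λ.real Set.univ)) * (a ^ k / k.factorial)) *
      Λ (missSet C) ^ k = ENNReal.ofReal (Real.exp (-(a * Λ.real Set.univ)) *
        ((a * Λ.real (missSet C)) ^ k / k.factorial)) := by
    intro k
    rw [← ofReal_measureReal (μ := Λ) (s := missSet C), ← ENNReal.ofReal_pow (by positivity),
      ← ENNReal.ofReal_mul (by positivity)]
    congr 1
    rw [mul_pow]
    ring
  simp only [h2]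
  rw [tsum_ofReal_pow_div_factorial (by positivity) _ (by positivity), ← Real.exp_add, h1]
  congr 2
  ring

theorem isProbabilityMeasure_poissonUnion (Λ : Measure (Closeds Y)) [IsFiniteMeasure Λ] {a : ℝ}
    (ha : 0 ≤ a) : IsProbabilityMeasure (poissonUnion Λ a) := by
  have h : missSet (∅ : Set Y) = Set.univ := by ext; simp [mem_missSet]
  constructor
  simpa [h] using poissonUnion_missSet Λ ha (isCompact_empty (X := Y))

/-- Superposition: the exponent of the void probability is additive in the intensity measure, and a
union misses C iff both parts do. -/
theorem poissonUnion_add (Λ₁ Λ₂ : Measure (Closeds Y)) [IsFiniteMeasure Λ₁] [IsFiniteMeasure Λ₂]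
    {a : ℝ} (ha : 0 ≤ a) :
    poissonUnion (Λ₁ + Λ₂) a =
      ((poissonUnion Λ₁ a).prod (poissonUnion Λ₂ a)).map (fun p => p.1 ⊔ p.2) := by
  have := isProbabilityMeasure_poissonUnion (Λ₁ + Λ₂) ha
  have := isProbabilityMeasure_poissonUnion Λ₁ ha
  have := isProbabilityMeasure_poissonUnion Λ₂ ha
  refine measure_ext_of_missSet fun C hC => ?_
  have h : (fun p : Closeds Y × Closeds Y => p.1 ⊔ p.2) ⁻¹' missSet C =
      missSet C ×ˢ missSet C := by
    ext p
    exact sup_mem_missSet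
  rw [Measure.map_apply measurable_sup_closeds (measurableSet_missSet hC), h, Measure.prod_prod,
    poissonUnion_missSet _ ha hC, poissonUnion_missSet _ ha hC, poissonUnion_missSet _ ha hC,
    ← ENNReal.ofReal_mul (by positivity), ← Real.exp_add, measureReal_add_apply]
  congr 2
  ring

/-- Conditioning on missing D only deletes the grains that hit D: a grain hits C ∪ D iff it hits D,
or hits C while missing D, and void probabilities factor accordingly. -/
theorem poissonUnion_restrict_missSet (Λ : Measure (Closeds Y)) [IsFiniteMeasure Λ]
    {a : ℝ} (ha : 0 ≤ a) {D : Set Y} (hD : IsCompact D) :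
    (poissonUnion Λ a).restrict (missSet D) =
      (poissonUnion Λ a (missSet D)) • poissonUnion (Λ.restrict (missSet D)) a := by
  have := isProbabilityMeasure_poissonUnion Λ ha
  refine measure_ext_of_missSet fun C hC => ?_
  rw [Measure.restrict_apply (measurableSet_missSet hC), missSet_inter, Measure.smul_apply,
    smul_eq_mul, poissonUnion_missSet _ ha (hC.union hD), poissonUnion_missSet _ ha hD,
    poissonUnion_missSet _ ha hC, ← ENNReal.ofReal_mul (by positivity), ← Real.exp_add]
  congr 2
  have h1 : (Λ.restrict (missSet D)).real (missSet C)ᶜ = Λ.real ((missSet C)ᶜ ∩ missSet D) := by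
    rw [measureReal_restrict_apply (measurableSet_missSet hC).compl]
  have h2 := measureReal_inter_add_sdiff (μ := Λ) (s := (missSet (C ∪ D))ᶜ)
    (measurableSet_missSet hD)
  have h3 : (missSet (C ∪ D))ᶜ ∩ missSet D = (missSet C)ᶜ ∩ missSet D := by
    rw [← missSet_inter]; ext; simp +contextual
  have h4 : (missSet (C ∪ D))ᶜ \ missSet D = (missSet D)ᶜ := by
    rw [← missSet_inter]; ext; simp +contextual
  rw [h1, ← h2, h3, h4]
  ring

theorem ae_mem_unionPow {Λ : Measure (Closeds Y)} [IsFiniteMeasure Λ] {S : Set (Closeds Y)}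
    (hS : MeasurableSet S) (hbot : ⊥ ∈ S) (hsup : ∀ K ∈ S, ∀ L ∈ S, K ⊔ L ∈ S)
    (hΛ : ∀ᵐ K ∂Λ, K ∈ S) (k : ℕ) : ∀ᵐ Z ∂(unionPow Λ k), Z ∈ S := by
  induction k with
  | zero => exact (ae_dirac_iff (p := (· ∈ S)) hS).2 hbot
  | succ k ih =>
    refine (ae_map_iff (p := (· ∈ S)) measurable_sup_closeds.aemeasurable hS).2 ?_
    have h1 := Measure.quasiMeasurePreserving_fst (μ := unionPow Λ k) (ν := Λ) |>.ae ih
    have h2 := Measure.quasiMeasurePreserving_snd (μ := unionPow Λ k) (ν := Λ) |>.ae hΛ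
    filter_upwards [h1, h2] with p hp1 hp2 using hsup _ hp1 _ hp2

theorem ae_mem_poissonUnion {Λ : Measure (Closeds Y)} [IsFiniteMeasure Λ] {S : Set (Closeds Y)}
    (hS : MeasurableSet S) (hbot : ⊥ ∈ S) (hsup : ∀ K ∈ S, ∀ L ∈ S, K ⊔ L ∈ S)
    (hΛ : ∀ᵐ K ∂Λ, K ∈ S) (a : ℝ) : ∀ᵐ Z ∂(poissonUnion Λ a), Z ∈ S := by
  rw [poissonUnion, Measure.ae_sum_eq, Filter.eventually_iSup]
  intro k
  exact Measure.ae_smul_measure (ae_mem_unionPow hS hbot hsup hΛ k) _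

/-- Harris type inequality: an increasing function and the event that `D` is not hit are
negatively correlated. -/
theorem setLIntegral_missSet_le {Λ : Measure (Closeds Y)} [IsFiniteMeasure Λ]
    {S : Set (Closeds Y)}
    (hS : MeasurableSet S) (hbot : ⊥ ∈ S) (hsup : ∀ K ∈ S, ∀ L ∈ S, K ⊔ L ∈ S)
    (hΛ : ∀ᵐ K ∂Λ, K ∈ S) {a : ℝ} (ha : 0 ≤ a) {D : Set Y} (hD : IsCompact D)
    {G : Closeds Y → ℝ≥0∞} (hG : Measurable G) (hmono : ∀ K ∈ S, ∀ L ∈ S, G K ≤ G (K ⊔ L)) :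
    ∫⁻ Z in missSet D, G Z ∂(poissonUnion Λ a) ≤
      poissonUnion Λ a (missSet D) * ∫⁻ Z, G Z ∂(poissonUnion Λ a) := by
  rw [poissonUnion_restrict_missSet Λ ha hD, lintegral_smul_measure, smul_eq_mul]
  refine mul_le_mul_right ?_ _
  set A := missSet D
  have := isProbabilityMeasure_poissonUnion (Λ.restrict A) ha
  have := isProbabilityMeasure_poissonUnion (Λ.restrict Aᶜ) ha
  -- The unconditioned union is the conditioned one joined with an independent union of the grains
  -- hitting D, and joining can only increase G.
  have hadd := poissonUnion_add (Λ.restrict A) (Λ.restrict Aᶜ) ha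
  rw [Measure.restrict_add_restrict_compl (measurableSet_missSet hD)] at hadd
  have hm : Measurable fun p : Closeds Y × Closeds Y => G (p.1 ⊔ p.2) :=
    hG.comp measurable_sup_closeds
  rw [hadd, lintegral_map hG measurable_sup_closeds, lintegral_prod _ hm.aemeasurable]
  have h1 := ae_mem_poissonUnion hS hbot hsup (ae_restrict_of_ae (s := A) hΛ) a
  have h2 := ae_mem_poissonUnion hS hbot hsup (ae_restrict_of_ae (s := Aᶜ) hΛ) a
  refine lintegral_mono_ae ?_
  filter_upwards [h1] with Z hZ
  calc G Z = ∫⁻ _, G Z ∂(poissonUnion (Λ.restrict Aᶜ) a) := by simp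
    _ ≤ _ := lintegral_mono_ae (by filter_upwards [h2] with W hW using hmono Z hZ W hW)

end PoissonUnion

/-! ### Differentiation in the intensity parameter -/

theorem hasDerivAt_tsum_pow_div_factorial {c : ℕ → ℝ} {A C : ℝ}
    (hc : ∀ k, |c k| ≤ A * C ^ k) (_ : 0 ≤ A) (_ : 0 ≤ C) (a : ℝ) :
    HasDerivAt (fun x : ℝ => ∑' k : ℕ, x ^ k / k.factorial * c k)
      (∑' k : ℕ, a ^ k / k.factorial * c (k + 1)) a := by
  -- The interval (-R, R) must contain both a and 0, since 0 is the base point at which the series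
  -- converges trivially.
  set R : ℝ := |a| + 1
  have hR : 0 ≤ R := by positivity
  let g' : ℕ → ℝ → ℝ := fun k x => (k * x ^ (k - 1)) / k.factorial * c k
  let b : ℕ → ℝ := fun k => (k * R ^ (k - 1)) / k.factorial * (A * C ^ k)
  have hbsucc : ∀ k, b (k + 1) = (A * C) * ((R * C) ^ k / k.factorial) := by
    intro k
    simp only [b, Nat.factorial_succ, Nat.add_sub_cancel, mul_pow, pow_succ]
    push_cast
    field_simp
  have hb : Summable b := by
    rw [← summable_nat_add_iff 1]
    simp only [hbsucc]
    exact (Real.summable_pow_div_factorial _).mul_left _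
  have hg'succ : ∀ k x, g' (k + 1) x = x ^ k / k.factorial * c (k + 1) := by
    intro k x
    simp only [g', Nat.factorial_succ, Nat.add_sub_cancel]
    push_cast
    field_simp
  have hbound : ∀ k, ∀ x ∈ Set.Ioo (-R) R, ‖g' k x‖ ≤ b k := by
    intro k x hx
    have hx' : |x| ≤ R := abs_le.2 ⟨hx.1.le, hx.2.le⟩
    simp only [g', b, norm_mul, norm_div, norm_pow, Real.norm_eq_abs, Nat.abs_cast]
    gcongr
    exact hc k
  have ha : a ∈ Set.Ioo (-R) R := by
    have := neg_abs_le a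
    have := le_abs_self a
    constructor <;> simp only [R] <;> linarith
  have hR0 : (0 : ℝ) ∈ Set.Ioo (-R) R := by
    have := abs_nonneg a
    constructor <;> simp only [R] <;> linarith
  have hd := hasDerivAt_tsum_of_isPreconnected (g := fun k x => x ^ k / (k.factorial : ℝ) * c k)
    (g' := g') hb isOpen_Ioo isPreconnected_Ioo
    (fun k x _ => ((hasDerivAt_pow k x).div_const _).mul_const _) hbound hR0
    (summable_of_ne_finset_zero (s := {0}) (by
      intro k hk
      have : k ≠ 0 := by simpa using hk
      simp [this])) ha
  have hsum : Summable fun k => g' k a := Summable.of_norm_bounded hb fun k => hbound k a ha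
  rw [hsum.tsum_eq_zero_add] at hd
  simpa [hg'succ, g'] using hd

section Deriv

variable {Y : Type*} [TopologicalSpace Y]

/-- Moment bound which makes the intensity expansion of `∫ f d(poissonUnion Λ a)` converge. -/
def HasGeometricMoments (Λ : Measure (Closeds Y)) (f : Closeds Y → ℝ≥0∞) : Prop :=
  ∃ A C : ℝ≥0, ∀ k, ∫⁻ Z, f Z ∂(unionPow Λ k) ≤ A * C ^ k

theorem HasGeometricMoments.ne_top {Λ : Measure (Closeds Y)} {f : Closeds Y → ℝ≥0∞}
    (h : HasGeometricMoments Λ f) (k : ℕ) : ∫⁻ Z, f Z ∂(unionPow Λ k) ≠ ∞ := by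
  obtain ⟨A, C, h⟩ := h
  exact ne_top_of_le_ne_top (by finiteness) (h k)

theorem HasGeometricMoments.toReal_le {Λ : Measure (Closeds Y)} {f : Closeds Y → ℝ≥0∞}
    (h : HasGeometricMoments Λ f) : ∃ A C : ℝ, 0 ≤ A ∧ 0 ≤ C ∧
      ∀ k, |(∫⁻ Z, f Z ∂(unionPow Λ k)).toReal| ≤ A * C ^ k := by
  obtain ⟨A, C, h⟩ := h
  refine ⟨A, C, A.2, C.2, fun k => ?_⟩
  rw [abs_of_nonneg ENNReal.toReal_nonneg]
  have := ENNReal.toReal_mono (by finiteness) (h k)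
  simpa using this

theorem HasGeometricMoments.lintegral_poissonUnion_eq {Λ : Measure (Closeds Y)}
    {f : Closeds Y → ℝ≥0∞} (h : HasGeometricMoments Λ f) {a : ℝ} (ha : 0 ≤ a) :
    ∫⁻ Z, f Z ∂(poissonUnion Λ a) = ENNReal.ofReal (Real.exp (-(a * Λ.real Set.univ)) *
      ∑' k : ℕ, a ^ k / k.factorial * (∫⁻ Z, f Z ∂(unionPow Λ k)).toReal) := by
  obtain ⟨A, C, hA, hC, hAC⟩ := h.toReal_le
  have hsum : Summable fun k : ℕ =>
      a ^ k / k.factorial * (∫⁻ Z, f Z ∂(unionPow Λ k)).toReal := by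
    refine Summable.of_nonneg_of_le (fun k => by positivity) (fun k => ?_)
      ((Real.summable_pow_div_factorial (a * C)).mul_left A)
    calc a ^ k / k.factorial * (∫⁻ Z, f Z ∂(unionPow Λ k)).toReal
        ≤ a ^ k / k.factorial * (A * C ^ k) := by
          gcongr
          exact (le_abs_self _).trans (hAC k)
      _ = _ := by rw [mul_pow]; ring
  rw [lintegral_poissonUnion, ← tsum_mul_left, ENNReal.ofReal_tsum_of_nonneg
    (fun k => by positivity) (hsum.mul_left _)]
  congr 1
  ext k
  rw [← mul_assoc, ENNReal.ofReal_mul (p := Real.exp _ * _) (by positivity),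
    ENNReal.ofReal_toReal (h.ne_top k)]

theorem HasGeometricMoments.lintegral_poissonUnion_ne_top {Λ : Measure (Closeds Y)}
    {f : Closeds Y → ℝ≥0∞} (h : HasGeometricMoments Λ f) {a : ℝ} (ha : 0 ≤ a) :
    ∫⁻ Z, f Z ∂(poissonUnion Λ a) ≠ ∞ := by
  rw [h.lintegral_poissonUnion_eq ha]
  exact ENNReal.ofReal_ne_top

/-- The expectation of `f` as a real function of the intensity parameter. -/
def intensityExp (Λ : Measure (Closeds Y)) (f : Closeds Y → ℝ≥0∞) (a : ℝ) : ℝ :=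
  Real.exp (-(a * Λ.real Set.univ)) *
      ∑' k : ℕ, a ^ k / k.factorial * (∫⁻ Z, f Z ∂(unionPow Λ k)).toReal

theorem HasGeometricMoments.toReal_lintegral {Λ : Measure (Closeds Y)}
    {f : Closeds Y → ℝ≥0∞} (h : HasGeometricMoments Λ f) {a : ℝ} (ha : 0 ≤ a) :
    (∫⁻ Z, f Z ∂(poissonUnion Λ a)).toReal = intensityExp Λ f a := by
  rw [h.lintegral_poissonUnion_eq ha, intensityExp, ENNReal.toReal_ofReal]
  exact mul_nonneg (Real.exp_nonneg _) (tsum_nonneg fun k => by positivity)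

theorem intensityExp_zero {Λ : Measure (Closeds Y)} {f : Closeds Y → ℝ≥0∞} (hf : Measurable f) :
    intensityExp Λ f 0 = (f ⊥).toReal := by
  rw [intensityExp, tsum_eq_single 0]
  · simp [unionPow, lintegral_dirac' _ hf]
  · intro k hk
    simp [hk]

variable [T2Space Y] [LocallyCompactSpace Y] [SecondCountableTopology Y]

/-- Adding one more grain moves the k-th moment to the (k+1)-st, so the extra factor C is absorbed
into A. -/
theorem HasGeometricMoments.shift {Λ : Measure (Closeds Y)} [IsFiniteMeasure Λ]
    {f : Closeds Y → ℝ≥0∞}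
    (h : HasGeometricMoments Λ f) (hf : Measurable f) :
    HasGeometricMoments Λ (fun Z => ∫⁻ K, f (Z ⊔ K) ∂Λ) := by
  obtain ⟨A, C, h⟩ := h
  refine ⟨A * C, C, fun k => ?_⟩
  rw [← lintegral_unionPow_succ Λ k hf]
  refine (h (k + 1)).trans (le_of_eq ?_)
  push_cast
  ring

/-- Russo–Margulis formula E ∫ (f(Z ∪ K) - f(Z)) Λ(dK): differentiating the power series gives the
gain, differentiating the factor e^{-aΛ(univ)} gives the loss. `intensityExp` is a series defined
for every real a, so the derivative is two-sided even at a = 0. -/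
theorem HasGeometricMoments.hasDerivAt {Λ : Measure (Closeds Y)} [IsFiniteMeasure Λ]
    {f : Closeds Y → ℝ≥0∞} (h : HasGeometricMoments Λ f) (hf : Measurable f) {a : ℝ}
    (ha : 0 ≤ a) :
    HasDerivAt (intensityExp Λ f)
      ((∫⁻ Z, ∫⁻ K, f (Z ⊔ K) ∂Λ ∂(poissonUnion Λ a)).toReal -
        Λ.real Set.univ * intensityExp Λ f a) a := by
  obtain ⟨A, C, hA, hC, hAC⟩ := h.toReal_le
  have h1 := hasDerivAt_tsum_pow_div_factorial hAC hA hC a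
  have h2 : HasDerivAt (fun x : ℝ => Real.exp (-(x * Λ.real Set.univ)))
      (Real.exp (-(a * Λ.real Set.univ)) * (-(1 * Λ.real Set.univ))) a :=
    ((hasDerivAt_id a).mul_const _).neg.exp
  refine (h2.mul h1).congr_deriv ?_
  rw [(h.shift hf).toReal_lintegral ha, intensityExp, intensityExp]
  simp only [lintegral_unionPow_succ Λ _ hf]
  ring

end Deriv

/-! ### The exponential moment bound for finite intensity measures -/

section Grains

variable {Y : Type*} [TopologicalSpace Y] [MeasurableSpace Y]

/-- The content `ρ(K)` for `K ∈ S`, and `0` outside of `S`. -/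
def grainContent (ρ : Measure Y) (S : Set (Closeds Y)) : Closeds Y → ℝ≥0∞ :=
  S.indicator fun K => ρ (K : Set Y)

/-- A measurable class of closed sets of finite content containing `∅`, closed under finite
unions, and on which the content is measurable. -/
structure IsGrainClass (ρ : Measure Y) (S : Set (Closeds Y)) : Prop where
  measurableSet : MeasurableSet S
  bot_mem : ⊥ ∈ S
  sup_mem : ∀ K ∈ S, ∀ L ∈ S, K ⊔ L ∈ S
  lt_top : ∀ K ∈ S, ρ (K : Set Y) < ∞
  measurable_content : Measurable (grainContent ρ S)

/-- The expected content of the part of `K` which is not covered by the Poisson union. -/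
def uncovered (ρ : Measure Y) (S : Set (Closeds Y)) (Λ : Measure (Closeds Y)) (a : ℝ)
    (K : Closeds Y) : ℝ≥0∞ :=
  ∫⁻ Z, (grainContent ρ S (Z ⊔ K) - grainContent ρ S Z) ∂(poissonUnion Λ a)

/-- The exponential `e^{s ρ(K)}`. -/
def expContent (ρ : Measure Y) (S : Set (Closeds Y)) (s : ℝ) (K : Closeds Y) : ℝ≥0∞ :=
  ENNReal.ofReal (Real.exp (s * (grainContent ρ S K).toReal))

/-- The weight `(e^{s ρ(K)} - 1 - s ρ(K)) / ρ(K)`. -/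
def expExcess (ρ : Measure Y) (S : Set (Closeds Y)) (s : ℝ) (K : Closeds Y) : ℝ≥0∞ :=
  ENNReal.ofReal (Real.exp (s * (grainContent ρ S K).toReal) - 1 -
    s * (grainContent ρ S K).toReal) / grainContent ρ S K

theorem grainContent_of_mem {ρ : Measure Y} {S : Set (Closeds Y)} {K : Closeds Y} (hK : K ∈ S) :
    grainContent ρ S K = ρ (K : Set Y) := Set.indicator_of_mem hK _

theorem grainContent_bot (ρ : Measure Y) (S : Set (Closeds Y)) :
    grainContent ρ S ⊥ = 0 := by
  simp [grainContent, Set.indicator]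

namespace IsGrainClass

variable {ρ : Measure Y} {S : Set (Closeds Y)}

theorem content_ne_top (hS : IsGrainClass ρ S) (K : Closeds Y) : grainContent ρ S K ≠ ∞ := by
  by_cases hK : K ∈ S
  · rw [grainContent_of_mem hK]; exact (hS.lt_top K hK).ne
  · simp [grainContent, hK]

theorem measurable_expContent (hS : IsGrainClass ρ S) (s : ℝ) :
    Measurable (expContent ρ S s) := by
  unfold expContent
  have := hS.measurable_content
  fun_prop

theorem measurable_expExcess (hS : IsGrainClass ρ S) (s : ℝ) :
    Measurable (expExcess ρ S s) := by
  unfold expExcess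
  have := hS.measurable_content
  fun_prop

variable [OpensMeasurableSpace Y]

theorem content_sup (hS : IsGrainClass ρ S) {Z K : Closeds Y} (hZ : Z ∈ S) (hK : K ∈ S) :
    grainContent ρ S (Z ⊔ K) = grainContent ρ S Z + ρ ((K : Set Y) \ Z) := by
  rw [grainContent_of_mem (hS.sup_mem Z hZ K hK), grainContent_of_mem hZ, Closeds.coe_sup,
    ← Set.union_sdiff_self, measure_union Set.disjoint_sdiff_right
      (K.isClosed.measurableSet.diff Z.isClosed.measurableSet)]

theorem content_sup_sub (hS : IsGrainClass ρ S) {Z K : Closeds Y} (hZ : Z ∈ S) (hK : K ∈ S) :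
    grainContent ρ S (Z ⊔ K) - grainContent ρ S Z = ρ ((K : Set Y) \ Z) := by
  rw [hS.content_sup hZ hK, ENNReal.add_sub_cancel_left (hS.content_ne_top Z)]

theorem content_sup_le (hS : IsGrainClass ρ S) {Z K : Closeds Y} (hZ : Z ∈ S) (hK : K ∈ S) :
    grainContent ρ S (Z ⊔ K) ≤ grainContent ρ S Z + grainContent ρ S K := by
  rw [hS.content_sup hZ hK, grainContent_of_mem hK]
  gcongr
  exact Set.sdiff_subset

theorem content_le_sup (hS : IsGrainClass ρ S) {Z K : Closeds Y} (hZ : Z ∈ S) (hK : K ∈ S) :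
    grainContent ρ S Z ≤ grainContent ρ S (Z ⊔ K) := by
  rw [hS.content_sup hZ hK]
  exact le_self_add

theorem expContent_le_sup (hS : IsGrainClass ρ S) {s : ℝ} (hs : 0 ≤ s) :
    ∀ Z ∈ S, ∀ K ∈ S, expContent ρ S s Z ≤ expContent ρ S s (Z ⊔ K) := by
  intro Z hZ K hK
  refine ENNReal.ofReal_le_ofReal (Real.exp_le_exp.2 (mul_le_mul_of_nonneg_left ?_ hs))
  exact ENNReal.toReal_mono (hS.content_ne_top _) (hS.content_le_sup hZ hK)

theorem expContent_sup_le_mul (hS : IsGrainClass ρ S) {s : ℝ} (hs : 0 ≤ s) {Z K : Closeds Y}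
    (hZ : Z ∈ S) (hK : K ∈ S) :
    expContent ρ S s (Z ⊔ K) ≤ expContent ρ S s Z * expContent ρ S s K := by
  rw [expContent, expContent, expContent, ← ENNReal.ofReal_mul (by positivity), ← Real.exp_add,
    ← mul_add, ← ENNReal.toReal_add (hS.content_ne_top _) (hS.content_ne_top _)]
  refine ENNReal.ofReal_le_ofReal (Real.exp_le_exp.2 (mul_le_mul_of_nonneg_left ?_ hs))
  exact ENNReal.toReal_mono (ENNReal.add_ne_top.2 ⟨hS.content_ne_top _, hS.content_ne_top _⟩)
    (hS.content_sup_le hZ hK)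

/-- On [0, k] the convex function e^{sx} - 1 lies below its chord. The slope (e^{sk} - 1)/k is split
into excess plus s because the part s later cancels against the derivative of the mean, while the
excess is what produces h. -/
theorem exp_mul_sub_one_le {s x k : ℝ} (hx : 0 ≤ x) (hxk : x ≤ k) (hk : 0 < k) :
    Real.exp (s * x) - 1 ≤ x * ((Real.exp (s * k) - 1 - s * k) / k) + s * x := by
  have h := convexOn_exp.2 (Set.mem_univ (s * k)) (Set.mem_univ 0)
    (show 0 ≤ x / k by positivity) (show 0 ≤ 1 - x / k by rwa [sub_nonneg, div_le_one hk])
    (by ring)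
  simp only [smul_eq_mul, mul_zero, add_zero, Real.exp_zero, mul_one] at h
  have e1 : x / k * (s * k) = s * x := by field_simp
  rw [e1] at h
  have e2 : x * ((Real.exp (s * k) - 1 - s * k) / k) + s * x =
      x / k * Real.exp (s * k) - x / k := by field_simp; ring
  linarith

/-- Convexity of the exponential bounds the effect of adding a grain. -/
theorem expContent_sup_le (hS : IsGrainClass ρ S) {s : ℝ} (hs : 0 ≤ s) {Z K : Closeds Y}
    (hZ : Z ∈ S) (hK : K ∈ S) :
    expContent ρ S s (Z ⊔ K) ≤ expContent ρ S s Z + expContent ρ S s Z *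
      (grainContent ρ S (Z ⊔ K) - grainContent ρ S Z) *
        (expExcess ρ S s K + ENNReal.ofReal s) := by
  set z := (grainContent ρ S Z).toReal with hz
  set k := (grainContent ρ S K).toReal with hk
  set x := (ρ ((K : Set Y) \ Z)).toReal with hx
  have hxfin : ρ ((K : Set Y) \ Z) ≠ ∞ :=
    ne_top_of_le_ne_top (hS.lt_top K hK).ne (measure_mono Set.sdiff_subset)
  have hxk : x ≤ k := by
    rw [hx, hk, grainContent_of_mem hK]
    exact ENNReal.toReal_mono (hS.lt_top K hK).ne (measure_mono Set.sdiff_subset)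
  have hx0 : 0 ≤ x := ENNReal.toReal_nonneg
  have hsup : (grainContent ρ S (Z ⊔ K)).toReal = z + x := by
    rw [hS.content_sup hZ hK, ENNReal.toReal_add (hS.content_ne_top Z) hxfin]
  rw [hS.content_sup_sub hZ hK, expContent, hsup]
  -- A grain of content zero adds nothing, so the division in `expExcess` matters only for k > 0.
  rcases eq_or_lt_of_le (hx0.trans hxk) with hk0 | hk0
  · have : x = 0 := le_antisymm (hk0 ▸ hxk) hx0
    rw [this, add_zero]
    exact le_self_add
  · have hexc : expExcess ρ S s K = ENNReal.ofReal ((Real.exp (s * k) - 1 - s * k) / k) := by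
      rw [expExcess, ENNReal.ofReal_div_of_pos hk0, hk,
        ENNReal.ofReal_toReal (hS.content_ne_top K)]
    have hnn : 0 ≤ (Real.exp (s * k) - 1 - s * k) / k := by
      have := Real.add_one_le_exp (s * k)
      exact div_nonneg (by linarith) hk0.le
    have hρ : ρ ((K : Set Y) \ Z) = ENNReal.ofReal x := (ENNReal.ofReal_toReal hxfin).symm
    rw [hexc, hρ, expContent, ← ENNReal.ofReal_add hnn hs, ← ENNReal.ofReal_mul (by positivity),
      ← ENNReal.ofReal_mul (by positivity), ← ENNReal.ofReal_add (by positivity) (by positivity)]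
    refine ENNReal.ofReal_le_ofReal ?_
    have h := exp_mul_sub_one_le (s := s) hx0 hxk hk0
    have h2 : Real.exp (s * (z + x)) = Real.exp (s * z) * Real.exp (s * x) := by
      rw [← Real.exp_add]; ring_nf
    rw [h2]
    have h3 := mul_le_mul_of_nonneg_left h (Real.exp_nonneg (s * z))
    calc Real.exp (s * z) * Real.exp (s * x)
        = Real.exp (s * z) + Real.exp (s * z) * (Real.exp (s * x) - 1) := by ring
      _ ≤ _ := by
        refine (add_le_add_right h3 _).trans (le_of_eq ?_)
        ring

end IsGrainClass

end Grains

/-! ### The uncovered part of a grain and its correlation with increasing functions. -/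

section Uncovered

variable {Y : Type*} [TopologicalSpace Y] [T2Space Y] [LocallyCompactSpace Y]
  [SecondCountableTopology Y] [MeasurableSpace Y]
  {ρ : Measure Y} {S : Set (Closeds Y)} {Λ : Measure (Closeds Y)} [IsFiniteMeasure Λ]

namespace IsGrainClass

theorem ae_mem_poissonUnion (hS : IsGrainClass ρ S) (hΛ : ∀ᵐ K ∂Λ, K ∈ S) (a : ℝ) :
    ∀ᵐ Z ∂(poissonUnion Λ a), Z ∈ S :=
  BooleanModel.ae_mem_poissonUnion hS.measurableSet hS.bot_mem hS.sup_mem hΛ a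

theorem measurable_content_sup (hS : IsGrainClass ρ S) :
    Measurable fun p : Closeds Y × Closeds Y => grainContent ρ S (p.1 ⊔ p.2) :=
  hS.measurable_content.comp measurable_sup_closeds

theorem measurable_content_sup_sub (hS : IsGrainClass ρ S) :
    Measurable fun p : Closeds Y × Closeds Y =>
      grainContent ρ S (p.1 ⊔ p.2) - grainContent ρ S p.1 :=
  hS.measurable_content_sup.sub (hS.measurable_content.comp measurable_fst)

variable [BorelSpace Y]

/-- Fubini applied to ρ(K \ Z) = ∫_K 1{y ∉ Z} ρ(dy), which reduces correlations with the gain to the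
events of missing a single point. -/
theorem lintegral_mul_content_sup_sub (hS : IsGrainClass ρ S) (hΛ : ∀ᵐ K ∂Λ, K ∈ S) {a : ℝ}
    (ha : 0 ≤ a) {G : Closeds Y → ℝ≥0∞} (hG : Measurable G) {K : Closeds Y} (hK : K ∈ S) :
    ∫⁻ Z, G Z * (grainContent ρ S (Z ⊔ K) - grainContent ρ S Z) ∂(poissonUnion Λ a) =
      ∫⁻ y in (K : Set Y), ∫⁻ Z in missSet {y}, G Z ∂(poissonUnion Λ a) ∂ρ := by
  have := isProbabilityMeasure_poissonUnion Λ ha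
  -- ρ is not assumed σ-finite; Fubini is available because its restriction to one grain is finite.
  have : IsFiniteMeasure (ρ.restrict (K : Set Y)) :=
    ⟨by simpa using hS.lt_top K hK⟩
  have hmeas : Measurable fun p : Closeds Y × Y => ({p : Closeds Y × Y | p.2 ∉ p.1}.indicator
      (fun p => G p.1)) p := by
    refine (hG.comp measurable_fst).indicator ?_
    exact (measurable_swap measurableSet_mem_closeds).compl
  have h1 : ∀ᵐ Z ∂(poissonUnion Λ a),
      G Z * (grainContent ρ S (Z ⊔ K) - grainContent ρ S Z) =
        ∫⁻ y in (K : Set Y), {p : Closeds Y × Y | p.2 ∉ p.1}.indicator (fun p => G p.1) (Z, y)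
          ∂ρ := by
    filter_upwards [hS.ae_mem_poissonUnion hΛ a] with Z hZ
    have : (fun y => {p : Closeds Y × Y | p.2 ∉ p.1}.indicator (fun p => G p.1) (Z, y)) =
        ((Z : Set Y)ᶜ).indicator fun _ => G Z := by
      ext y
      by_cases hy : y ∈ Z <;> simp [Set.indicator, hy]
    rw [this, lintegral_indicator Z.isClosed.isOpen_compl.measurableSet, setLIntegral_const,
      Measure.restrict_apply Z.isClosed.isOpen_compl.measurableSet, hS.content_sup_sub hZ hK,
      Set.inter_comm, Set.sdiff_eq]
  rw [lintegral_congr_ae h1, lintegral_lintegral_swap hmeas.aemeasurable]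
  refine lintegral_congr fun y => ?_
  have : (fun Z => {p : Closeds Y × Y | p.2 ∉ p.1}.indicator (fun p => G p.1) (Z, y)) =
      (missSet {y}).indicator G := by
    ext Z
    by_cases hy : y ∈ Z <;> simp [Set.indicator, mem_missSet_singleton, hy]
  rw [this, lintegral_indicator (measurableSet_missSet isCompact_singleton)]

theorem uncovered_eq (hS : IsGrainClass ρ S) (hΛ : ∀ᵐ K ∂Λ, K ∈ S) {a : ℝ} (ha : 0 ≤ a)
    {K : Closeds Y} (hK : K ∈ S) :
    uncovered ρ S Λ a K = ∫⁻ y in (K : Set Y), poissonUnion Λ a (missSet {y}) ∂ρ := by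
  have := hS.lintegral_mul_content_sup_sub hΛ ha (G := fun _ => 1) measurable_const hK
  simpa [uncovered] using this

theorem uncovered_le (hS : IsGrainClass ρ S) (hΛ : ∀ᵐ K ∂Λ, K ∈ S) {a : ℝ} (ha : 0 ≤ a)
    {K : Closeds Y} (hK : K ∈ S) : uncovered ρ S Λ a K ≤ grainContent ρ S K := by
  have := isProbabilityMeasure_poissonUnion Λ ha
  rw [hS.uncovered_eq hΛ ha hK, grainContent_of_mem hK]
  calc _ ≤ ∫⁻ y in (K : Set Y), 1 ∂ρ := lintegral_mono fun y => prob_le_one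
    _ = _ := by simp

/-- The Harris inequality is applied with D = {y} for each point y of K and then integrated over K.
-/
theorem lintegral_mul_le_mul_uncovered (hS : IsGrainClass ρ S) (hΛ : ∀ᵐ K ∂Λ, K ∈ S) {a : ℝ}
    (ha : 0 ≤ a) {G : Closeds Y → ℝ≥0∞} (hG : Measurable G)
    (hmono : ∀ K ∈ S, ∀ L ∈ S, G K ≤ G (K ⊔ L))
    {K : Closeds Y} (hK : K ∈ S) :
    ∫⁻ Z, G Z * (grainContent ρ S (Z ⊔ K) - grainContent ρ S Z) ∂(poissonUnion Λ a) ≤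
      (∫⁻ Z, G Z ∂(poissonUnion Λ a)) * uncovered ρ S Λ a K := by
  rw [hS.lintegral_mul_content_sup_sub hΛ ha hG hK, hS.uncovered_eq hΛ ha hK,
    mul_comm (∫⁻ Z, G Z ∂(poissonUnion Λ a))]
  refine le_trans (lintegral_mono fun y => setLIntegral_missSet_le hS.measurableSet hS.bot_mem
    hS.sup_mem hΛ ha isCompact_singleton hG hmono) ?_
  have hm : Measurable fun y => poissonUnion Λ a (missSet {y}) := by
    have := isProbabilityMeasure_poissonUnion Λ ha
    convert measurable_measure_prodMk_left (ν := poissonUnion Λ a)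
      (measurableSet_mem_closeds (Y := Y)).compl with y
    ext Z
    simp [mem_missSet_singleton]
  rw [lintegral_mul_const _ hm]

end IsGrainClass

end Uncovered

/-- The origin of τ: it averages, over the intensity level a in (0,1], the probability e^{-az} that
a point hit with intensity z is uncovered. -/
theorem lintegral_exp_neg_mul_eq_tau {z : ℝ≥0∞} (hz : z ≠ ∞) :
    ∫⁻ a in Set.Ioc (0 : ℝ) 1, ENNReal.ofReal (Real.exp (-(a * z.toReal))) = tau z := by
  rcases eq_or_ne z 0 with rfl | hz0
  · simp [tau]
  have hpos : 0 < z.toReal := ENNReal.toReal_pos hz0 hz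
  set c := z.toReal
  have hcont : Continuous fun a : ℝ => Real.exp (-(a * c)) := by fun_prop
  rw [← ofReal_integral_eq_lintegral_ofReal (hcont.integrableOn_Ioc)
    (Filter.Eventually.of_forall fun a => (Real.exp_pos _).le),
    ← intervalIntegral.integral_of_le zero_le_one]
  have hd : ∀ x ∈ Set.uIcc (0 : ℝ) 1,
      HasDerivAt (fun a : ℝ => -Real.exp (-(a * c)) / c) (Real.exp (-(x * c))) x := by
    intro x _
    have h := (((hasDerivAt_id x).mul_const c).neg.exp).neg.div_const c
    refine h.congr_deriv ?_
    simp only [Pi.neg_apply, id]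
    field_simp
  rw [intervalIntegral.integral_eq_sub_of_hasDerivAt hd (hcont.intervalIntegrable _ _)]
  simp only [tau, hz0, hz, if_false]
  congr 1
  simp only [one_mul, zero_mul, neg_zero, Real.exp_zero]
  ring

/-! ### Growth of the mean and of the exponential moment along the intensity parameter. -/

section FiniteIntensity

variable {Y : Type*} [TopologicalSpace Y] [MeasurableSpace Y]

/-- `ρ*(K)` for an intensity measure on the space of all closed sets. -/
def rhoStarOn (ρ : Measure Y) (Λ : Measure (Closeds Y)) (K : Closeds Y) : ℝ≥0∞ :=
  ∫⁻ y in (K : Set Y), tau (Λ (missSet {y})ᶜ) ∂ρ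

variable {ρ : Measure Y} {S : Set (Closeds Y)} {Λ : Measure (Closeds Y)}

theorem IsGrainClass.content_le_mul_expContent (hS : IsGrainClass ρ S) {s : ℝ} (hs : 0 < s) (K : Closeds Y) :
    grainContent ρ S K ≤ ENNReal.ofReal s⁻¹ * expContent ρ S s K := by
  rw [expContent, ← ENNReal.ofReal_mul (by positivity),
    ← ENNReal.ofReal_toReal (hS.content_ne_top K)]
  refine ENNReal.ofReal_le_ofReal ?_
  rw [ENNReal.toReal_ofReal ENNReal.toReal_nonneg]
  have := Real.add_one_le_exp (s * (grainContent ρ S K).toReal)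
  rw [← div_eq_inv_mul, le_div_iff₀ hs]
  linarith

theorem expExcess_mul_content_le {s : ℝ} (hs : 0 ≤ s) (K : Closeds Y) :
    expExcess ρ S s K * grainContent ρ S K ≤ expContent ρ S s K := by
  rw [expExcess]
  refine (ENNReal.mul_le_of_le_div le_rfl).trans (ENNReal.ofReal_le_ofReal ?_)
  have : 0 ≤ s * (grainContent ρ S K).toReal := by positivity
  linarith

theorem IsGrainClass.lintegral_content_ne_top (hS : IsGrainClass ρ S) {s : ℝ} (hs : 0 < s)
    (hfin : ∫⁻ K, expContent ρ S s K ∂Λ ≠ ∞) : ∫⁻ K, grainContent ρ S K ∂Λ ≠ ∞ := by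
  refine ne_top_of_le_ne_top ?_ (lintegral_mono fun K => hS.content_le_mul_expContent hs K)
  rw [lintegral_const_mul _ (hS.measurable_expContent s)]
  exact ENNReal.mul_ne_top ENNReal.ofReal_ne_top hfin

variable [T2Space Y] [LocallyCompactSpace Y] [SecondCountableTopology Y] [IsFiniteMeasure Λ]

namespace IsGrainClass

theorem measurable_uncovered (hS : IsGrainClass ρ S) :
    Measurable (Function.uncurry (uncovered ρ S Λ)) := by
  unfold Function.uncurry
  simp only [uncovered, lintegral_poissonUnion]
  refine Measurable.tsum fun k => Measurable.mul (by fun_prop) ?_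
  have := hS.measurable_content_sup_sub.lintegral_prod_left' (μ := unionPow Λ k)
  exact this.comp measurable_snd

theorem measurable_expExcess_mul_uncovered (hS : IsGrainClass ρ S) (s : ℝ) :
    Measurable (Function.uncurry fun (a : ℝ) (K : Closeds Y) =>
      expExcess ρ S s K * uncovered ρ S Λ a K) :=
  Measurable.mul ((hS.measurable_expExcess s).comp measurable_snd)
    (hS.measurable_uncovered (Λ := Λ))

variable [BorelSpace Y]

theorem lintegral_uncovered (hS : IsGrainClass ρ S) (hΛ : ∀ᵐ K ∂Λ, K ∈ S)
    {K : Closeds Y} (hK : K ∈ S) :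
    ∫⁻ a in Set.Ioc (0 : ℝ) 1, uncovered ρ S Λ a K = rhoStarOn ρ Λ K := by
  have : IsFiniteMeasure (ρ.restrict (K : Set Y)) := ⟨by simpa using hS.lt_top K hK⟩
  have hm : Measurable fun y : Y => Λ.real (missSet {y})ᶜ := by
    refine Measurable.ennreal_toReal ?_
    convert measurable_measure_prodMk_left (ν := Λ) (measurableSet_mem_closeds (Y := Y)) with y
    ext Z
    simp [mem_missSet_singleton]
  have h1 : ∀ a ∈ Set.Ioc (0 : ℝ) 1, uncovered ρ S Λ a K =
      ∫⁻ y in (K : Set Y), ENNReal.ofReal (Real.exp (-(a * Λ.real (missSet {y})ᶜ))) ∂ρ := by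
    intro a ha
    rw [hS.uncovered_eq hΛ ha.1.le hK]
    exact lintegral_congr fun y => poissonUnion_missSet Λ ha.1.le isCompact_singleton
  rw [setLIntegral_congr_fun measurableSet_Ioc h1, lintegral_lintegral_swap]
  · exact lintegral_congr fun y => lintegral_exp_neg_mul_eq_tau (measure_ne_top _ _)
  · refine Measurable.aemeasurable ?_
    have hm' : Measurable fun p : ℝ × Y => Λ.real (missSet {p.2})ᶜ := hm.comp measurable_snd
    unfold Function.uncurry
    fun_prop

/-- Subadditivity of ρ makes e^{sρ} submultiplicative under unions, so k grains cost at most the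
k-th power of the moment of one grain. -/
theorem hasGeometricMoments_expContent (hS : IsGrainClass ρ S) (hΛ : ∀ᵐ K ∂Λ, K ∈ S) {s : ℝ}
    (hs : 0 ≤ s) (hfin : ∫⁻ K, expContent ρ S s K ∂Λ ≠ ∞) :
    HasGeometricMoments Λ (expContent ρ S s) := by
  refine ⟨1, (∫⁻ K, expContent ρ S s K ∂Λ).toNNReal, fun k => ?_⟩
  rw [ENNReal.coe_toNNReal hfin]
  induction k with
  | zero =>
    rw [unionPow, lintegral_dirac' _ (hS.measurable_expContent s)]
    simp [expContent, grainContent_bot]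
  | succ k ih =>
    rw [lintegral_unionPow_succ Λ k (hS.measurable_expContent s)]
    have hk := ae_mem_unionPow hS.measurableSet hS.bot_mem hS.sup_mem hΛ k
    calc ∫⁻ Z, ∫⁻ K, expContent ρ S s (Z ⊔ K) ∂Λ ∂(unionPow Λ k)
        ≤ ∫⁻ Z, expContent ρ S s Z * ∫⁻ K, expContent ρ S s K ∂Λ ∂(unionPow Λ k) := by
          refine lintegral_mono_ae ?_
          filter_upwards [hk] with Z hZ
          rw [← lintegral_const_mul _ (hS.measurable_expContent s)]
          refine lintegral_mono_ae ?_
          filter_upwards [hΛ] with K hK using hS.expContent_sup_le_mul hs hZ hK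
      _ = (∫⁻ Z, expContent ρ S s Z ∂(unionPow Λ k)) * ∫⁻ K, expContent ρ S s K ∂Λ :=
          lintegral_mul_const _ (hS.measurable_expContent s)
      _ ≤ _ := by
          rw [pow_succ, ← mul_assoc]
          gcongr

theorem hasGeometricMoments_content (hS : IsGrainClass ρ S) (hΛ : ∀ᵐ K ∂Λ, K ∈ S) {s : ℝ}
    (hs : 0 < s) (hfin : ∫⁻ K, expContent ρ S s K ∂Λ ≠ ∞) :
    HasGeometricMoments Λ (grainContent ρ S) := by
  obtain ⟨A, C, h⟩ := hS.hasGeometricMoments_expContent hΛ hs.le hfin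
  refine ⟨s⁻¹.toNNReal * A, C, fun k => ?_⟩
  calc _ ≤ ∫⁻ Z, ENNReal.ofReal s⁻¹ * expContent ρ S s Z ∂(unionPow Λ k) :=
        lintegral_mono fun Z => hS.content_le_mul_expContent hs Z
    _ = ENNReal.ofReal s⁻¹ * ∫⁻ Z, expContent ρ S s Z ∂(unionPow Λ k) :=
        lintegral_const_mul _ (hS.measurable_expContent s)
    _ ≤ ENNReal.ofReal s⁻¹ * (A * C ^ k) := by gcongr; exact h k
    _ = _ := by push_cast; rw [mul_assoc]; rfl

theorem lintegral_content_sup (hS : IsGrainClass ρ S) (hΛ : ∀ᵐ K ∂Λ, K ∈ S) {a : ℝ}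
    (ha : 0 ≤ a) :
    ∫⁻ Z, ∫⁻ K, grainContent ρ S (Z ⊔ K) ∂Λ ∂(poissonUnion Λ a) =
      Λ Set.univ * (∫⁻ Z, grainContent ρ S Z ∂(poissonUnion Λ a)) +
        ∫⁻ K, uncovered ρ S Λ a K ∂Λ := by
  have := isProbabilityMeasure_poissonUnion Λ ha
  rw [lintegral_lintegral_swap hS.measurable_content_sup.aemeasurable]
  have h : ∀ᵐ K ∂Λ, ∫⁻ Z, grainContent ρ S (Z ⊔ K) ∂(poissonUnion Λ a) =
      (∫⁻ Z, grainContent ρ S Z ∂(poissonUnion Λ a)) + uncovered ρ S Λ a K := by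
    filter_upwards [hΛ] with K hK
    rw [uncovered, ← lintegral_add_left hS.measurable_content]
    refine lintegral_congr_ae ?_
    filter_upwards [hS.ae_mem_poissonUnion hΛ a] with Z hZ
    rw [add_tsub_cancel_of_le (hS.content_le_sup hZ hK)]
  rw [lintegral_congr_ae h, lintegral_add_left measurable_const, lintegral_const, mul_comm]

/-- Convexity followed by the Harris inequality. The first summand is the loss term of the
derivative formula and cancels there; the factor of s is the derivative of the mean content. -/
theorem lintegral_expContent_sup_le (hS : IsGrainClass ρ S) (hΛ : ∀ᵐ K ∂Λ, K ∈ S) {a : ℝ}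
    (ha : 0 ≤ a) {s : ℝ} (hs : 0 ≤ s) :
    ∫⁻ Z, ∫⁻ K, expContent ρ S s (Z ⊔ K) ∂Λ ∂(poissonUnion Λ a) ≤
      Λ Set.univ * (∫⁻ Z, expContent ρ S s Z ∂(poissonUnion Λ a)) +
        (∫⁻ Z, expContent ρ S s Z ∂(poissonUnion Λ a)) *
          (∫⁻ K, expExcess ρ S s K * uncovered ρ S Λ a K ∂Λ +
            ENNReal.ofReal s * ∫⁻ K, uncovered ρ S Λ a K ∂Λ) := by
  have := isProbabilityMeasure_poissonUnion Λ ha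
  have hG := hS.measurable_expContent s
  have hGs : Measurable fun p : Closeds Y × Closeds Y => expContent ρ S s (p.1 ⊔ p.2) :=
    hG.comp measurable_sup_closeds
  rw [lintegral_lintegral_swap hGs.aemeasurable]
  set u := ∫⁻ Z, expContent ρ S s Z ∂(poissonUnion Λ a)
  have hp : Measurable (uncovered ρ S Λ a) := hS.measurable_uncovered.of_uncurry_left
  have h : ∀ᵐ K ∂Λ, ∫⁻ Z, expContent ρ S s (Z ⊔ K) ∂(poissonUnion Λ a) ≤
      u + u * (expExcess ρ S s K * uncovered ρ S Λ a K +
        ENNReal.ofReal s * uncovered ρ S Λ a K) := by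
    filter_upwards [hΛ] with K hK
    have hgain' : Measurable fun Z => grainContent ρ S (Z ⊔ K) - grainContent ρ S Z :=
      hS.measurable_content_sup_sub.comp measurable_prodMk_right
    have hgain : Measurable fun Z => expContent ρ S s Z *
        (grainContent ρ S (Z ⊔ K) - grainContent ρ S Z) := hG.mul hgain'
    calc ∫⁻ Z, expContent ρ S s (Z ⊔ K) ∂(poissonUnion Λ a)
        ≤ ∫⁻ Z, (expContent ρ S s Z + expContent ρ S s Z *
            (grainContent ρ S (Z ⊔ K) - grainContent ρ S Z) *
              (expExcess ρ S s K + ENNReal.ofReal s)) ∂(poissonUnion Λ a) := by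
          refine lintegral_mono_ae ?_
          filter_upwards [hS.ae_mem_poissonUnion hΛ a] with Z hZ
          exact hS.expContent_sup_le hs hZ hK
      _ = u + (∫⁻ Z, expContent ρ S s Z *
            (grainContent ρ S (Z ⊔ K) - grainContent ρ S Z) ∂(poissonUnion Λ a)) *
              (expExcess ρ S s K + ENNReal.ofReal s) := by
          rw [lintegral_add_left hG, lintegral_mul_const _ hgain]
      _ ≤ u + (u * uncovered ρ S Λ a K) * (expExcess ρ S s K + ENNReal.ofReal s) := by
          gcongr
          exact hS.lintegral_mul_le_mul_uncovered hΛ ha hG (hS.expContent_le_sup hs) hK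
      _ = _ := by ring
  refine (lintegral_mono_ae h).trans (le_of_eq ?_)
  have hm1 : Measurable fun K => expExcess ρ S s K * uncovered ρ S Λ a K :=
    (hS.measurable_expExcess_mul_uncovered s).of_uncurry_left
  have hm2 : Measurable fun K => ENNReal.ofReal s * uncovered ρ S Λ a K := hp.const_mul _
  have hm3 : Measurable fun K => expExcess ρ S s K * uncovered ρ S Λ a K +
      ENNReal.ofReal s * uncovered ρ S Λ a K := hm1.add hm2
  rw [lintegral_add_left measurable_const, lintegral_const, lintegral_const_mul _ hm3,
    lintegral_add_left hm1, lintegral_const_mul _ hp, mul_comm]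

theorem lintegral_expExcess_mul_uncovered_le (hS : IsGrainClass ρ S) (hΛ : ∀ᵐ K ∂Λ, K ∈ S)
    {a : ℝ} (ha : 0 ≤ a) {s : ℝ} (hs : 0 ≤ s) :
    ∫⁻ K, expExcess ρ S s K * uncovered ρ S Λ a K ∂Λ ≤ ∫⁻ K, expContent ρ S s K ∂Λ := by
  refine lintegral_mono_ae ?_
  filter_upwards [hΛ] with K hK
  exact (mul_le_mul_right (hS.uncovered_le hΛ ha hK) _).trans (expExcess_mul_content_le hs K)

theorem lintegral_uncovered_le (hS : IsGrainClass ρ S) (hΛ : ∀ᵐ K ∂Λ, K ∈ S)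
    {a : ℝ} (ha : 0 ≤ a) :
    ∫⁻ K, uncovered ρ S Λ a K ∂Λ ≤ ∫⁻ K, grainContent ρ S K ∂Λ := by
  refine lintegral_mono_ae ?_
  filter_upwards [hΛ] with K hK using hS.uncovered_le hΛ ha hK

theorem hasDerivAt_intensityExp_content (hS : IsGrainClass ρ S) (hΛ : ∀ᵐ K ∂Λ, K ∈ S) {s : ℝ}
    (hs : 0 < s) (hfin : ∫⁻ K, expContent ρ S s K ∂Λ ≠ ∞) {a : ℝ} (ha : 0 ≤ a) :
    HasDerivAt (intensityExp Λ (grainContent ρ S)) (∫⁻ K, uncovered ρ S Λ a K ∂Λ).toReal a := by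
  have hgm := hS.hasGeometricMoments_content hΛ hs hfin
  refine (hgm.hasDerivAt hS.measurable_content ha).congr_deriv ?_
  have h1 := hgm.lintegral_poissonUnion_ne_top ha
  have h2 : ∫⁻ K, uncovered ρ S Λ a K ∂Λ ≠ ∞ :=
    ne_top_of_le_ne_top (hS.lintegral_content_ne_top hs hfin) (hS.lintegral_uncovered_le hΛ ha)
  rw [hS.lintegral_content_sup hΛ ha, ENNReal.toReal_add (by finiteness) h2, ENNReal.toReal_mul,
    hgm.toReal_lintegral ha, Measure.real]
  ring

/-- The expected content of the Poisson union. -/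
theorem lintegral_content_poissonUnion_le (hS : IsGrainClass ρ S) (hΛ : ∀ᵐ K ∂Λ, K ∈ S) {s : ℝ}
    (hs : 0 < s) (hfin : ∫⁻ K, expContent ρ S s K ∂Λ ≠ ∞) :
    ∫⁻ Z, grainContent ρ S Z ∂(poissonUnion Λ 1) ≤ ∫⁻ K, grainContent ρ S K ∂Λ := by
  have hgm := hS.hasGeometricMoments_content hΛ hs hfin
  have hR := hS.lintegral_content_ne_top hs hfin
  have h := intervalIntegral.sub_le_integral_of_hasDeriv_right_of_le (zero_le_one' ℝ)
    (g := intensityExp Λ (grainContent ρ S))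
    (φ := fun _ => (∫⁻ K, grainContent ρ S K ∂Λ).toReal)
    (fun a ha => (hS.hasDerivAt_intensityExp_content hΛ hs hfin
      ha.1).continuousAt.continuousWithinAt)
    (fun a ha => (hS.hasDerivAt_intensityExp_content hΛ hs hfin ha.1.le).hasDerivWithinAt)
    (integrableOn_const (by simp))
    (fun a ha => ENNReal.toReal_mono hR (hS.lintegral_uncovered_le hΛ ha.1.le))
  rw [intensityExp_zero hS.measurable_content, grainContent_bot,
    ← hgm.toReal_lintegral zero_le_one] at h
  simp only [ENNReal.toReal_zero, sub_zero, intervalIntegral.integral_const, smul_eq_mul,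
    one_mul] at h
  exact (ENNReal.toReal_le_toReal (hgm.lintegral_poissonUnion_ne_top zero_le_one) hR).1 h

theorem lintegral_expExcess_mul_uncovered (hS : IsGrainClass ρ S) (hΛ : ∀ᵐ K ∂Λ, K ∈ S) (s : ℝ) :
    ∫⁻ a in Set.Ioc (0 : ℝ) 1, ∫⁻ K, expExcess ρ S s K * uncovered ρ S Λ a K ∂Λ =
      ∫⁻ K, expExcess ρ S s K * rhoStarOn ρ Λ K ∂Λ := by
  rw [lintegral_lintegral_swap]
  · refine lintegral_congr_ae ?_
    filter_upwards [hΛ] with K hK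
    have hp : Measurable fun a => uncovered ρ S Λ a K :=
      hS.measurable_uncovered.of_uncurry_right
    rw [lintegral_const_mul _ hp, hS.lintegral_uncovered hΛ hK]
  · exact (hS.measurable_expExcess_mul_uncovered s).aemeasurable

/-- The exponential moment bound for the content of the Poisson union. -/
theorem lintegral_expContent_poissonUnion_le (hS : IsGrainClass ρ S) (hΛ : ∀ᵐ K ∂Λ, K ∈ S)
    {s : ℝ} (hs : 0 < s) (hfin : ∫⁻ K, expContent ρ S s K ∂Λ ≠ ∞) :
    ∫⁻ Z, expContent ρ S s Z ∂(poissonUnion Λ 1) ≤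
      ENNReal.ofReal (Real.exp (s * (∫⁻ Z, grainContent ρ S Z ∂(poissonUnion Λ 1)).toReal +
        (∫⁻ K, expExcess ρ S s K * rhoStarOn ρ Λ K ∂Λ).toReal)) := by
  have hgm := hS.hasGeometricMoments_content hΛ hs hfin
  have hge := hS.hasGeometricMoments_expContent hΛ hs.le hfin
  have hR := hS.lintegral_content_ne_top hs hfin
  set u := intensityExp Λ (expContent ρ S s) with hu
  set m := intensityExp Λ (grainContent ρ S) with hm
  let φ : ℝ → ℝ := fun a => (∫⁻ K, expExcess ρ S s K * uncovered ρ S Λ a K ∂Λ).toReal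
  let V : ℝ → ℝ := fun a => (∫⁻ K, uncovered ρ S Λ a K ∂Λ).toReal
  let u' : ℝ → ℝ := fun a => (∫⁻ Z, ∫⁻ K, expContent ρ S s (Z ⊔ K) ∂Λ ∂(poissonUnion Λ a)).toReal -
        Λ.real Set.univ * u a
  have hpos : ∀ a, 0 ≤ a → 1 ≤ u a := by
    intro a ha
    have := isProbabilityMeasure_poissonUnion Λ ha
    rw [hu, ← hge.toReal_lintegral ha, ← ENNReal.toReal_one]
    refine ENNReal.toReal_mono (hge.lintegral_poissonUnion_ne_top ha) ?_
    calc (1 : ℝ≥0∞) = ∫⁻ _, 1 ∂(poissonUnion Λ a) := by simp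
      _ ≤ _ := lintegral_mono fun Z => by
        rw [expContent, ENNReal.one_le_ofReal, Real.one_le_exp_iff]
        positivity
  have hu' : ∀ a, 0 ≤ a → HasDerivAt u (u' a) a := fun a ha =>
    hge.hasDerivAt (hS.measurable_expContent s) ha
  have hbound : ∀ a, 0 ≤ a → u' a ≤ u a * (φ a + s * V a) := by
    intro a ha
    have h := hS.lintegral_expContent_sup_le hΛ ha hs.le
    have h1 := hge.lintegral_poissonUnion_ne_top ha
    have h2 : ∫⁻ K, uncovered ρ S Λ a K ∂Λ ≠ ∞ :=
      ne_top_of_le_ne_top hR (hS.lintegral_uncovered_le hΛ ha)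
    have h3 : ∫⁻ K, expExcess ρ S s K * uncovered ρ S Λ a K ∂Λ ≠ ∞ :=
      ne_top_of_le_ne_top hfin (hS.lintegral_expExcess_mul_uncovered_le hΛ ha hs.le)
    have h4 := ENNReal.toReal_mono (by finiteness) h
    rw [ENNReal.toReal_add (by finiteness) (by finiteness), ENNReal.toReal_mul,
      ENNReal.toReal_mul, ENNReal.toReal_add h3 (by finiteness), ENNReal.toReal_mul,
      ENNReal.toReal_ofReal hs.le, hge.toReal_lintegral ha] at h4
    simp only [u', φ, V, Measure.real, ← hu] at h4 ⊢
    linarith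
  -- Subtracting s m removes the linear term s V from the differential inequality and leaves φ alone
  -- as an upper bound.
  have hderiv : ∀ a, 0 ≤ a →
      HasDerivAt (fun a => Real.log (u a) - s * m a) (u' a / u a - s * V a) a := by
    intro a ha
    exact ((hu' a ha).log (by linarith [hpos a ha] : 0 < u a).ne').sub
      ((hS.hasDerivAt_intensityExp_content hΛ hs hfin ha).const_mul s)
  have hφm : Measurable fun a => ∫⁻ K, expExcess ρ S s K * uncovered ρ S Λ a K ∂Λ :=
    (hS.measurable_expExcess_mul_uncovered s).lintegral_prod_right'
  have hφI : ∫⁻ a in Set.Icc (0 : ℝ) 1, ∫⁻ K, expExcess ρ S s K * uncovered ρ S Λ a K ∂Λ ≠ ∞ := by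
    refine ne_top_of_le_ne_top ?_ (setLIntegral_mono measurable_const fun a ha =>
      hS.lintegral_expExcess_mul_uncovered_le hΛ ha.1 hs.le)
    simpa using hfin
  -- Only the majorant φ has to be integrable here, not the derivative itself.
  have h := intervalIntegral.sub_le_integral_of_hasDeriv_right_of_le (zero_le_one' ℝ)
    (φ := φ)
    (fun a ha => (hderiv a ha.1).continuousAt.continuousWithinAt)
    (fun a ha => (hderiv a ha.1.le).hasDerivWithinAt)
    (integrable_toReal_of_lintegral_ne_top hφm.aemeasurable hφI)
    (fun a ha => by
      have hp : 0 < u a := by linarith [hpos a ha.1.le]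
      have : u' a / u a ≤ φ a + s * V a := by
        rw [div_le_iff₀ hp, mul_comm]
        exact hbound a ha.1.le
      linarith)
  have hint : ∫ a in (0 : ℝ)..1, φ a = (∫⁻ K, expExcess ρ S s K * rhoStarOn ρ Λ K ∂Λ).toReal := by
    rw [← hS.lintegral_expExcess_mul_uncovered hΛ s, intervalIntegral.integral_of_le zero_le_one,
      integral_toReal hφm.aemeasurable]
    refine ae_restrict_of_forall_mem measurableSet_Ioc fun a ha => ?_
    exact lt_of_le_of_lt (hS.lintegral_expExcess_mul_uncovered_le hΛ ha.1.le hs.le)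
      hfin.lt_top
  have hu0 : u 0 = 1 := by
    rw [hu, intensityExp_zero (hS.measurable_expContent s)]
    simp [expContent, grainContent_bot]
  have hm0 : m 0 = 0 := by
    rw [hm, intensityExp_zero hS.measurable_content, grainContent_bot, ENNReal.toReal_zero]
  rw [hint, hu0, hm0, Real.log_one] at h
  rw [hgm.toReal_lintegral zero_le_one, ← hm,
    ← ENNReal.ofReal_toReal (hge.lintegral_poissonUnion_ne_top zero_le_one),
    hge.toReal_lintegral zero_le_one, ← hu]
  refine ENNReal.ofReal_le_ofReal ?_
  rw [← Real.log_le_iff_le_exp (by linarith [hpos 1 zero_le_one])]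
  linarith

end IsGrainClass

end FiniteIntensity

/-! ### The union of the particles of a Poisson process in a set of finite intensity -/

section Particles

variable {Y : Type*} [TopologicalSpace Y] {𝓕 : Set (Closeds Y)}

/-- The union of the particles of `μ` in `A` if `μ A` is finite, and `∅` otherwise. -/
def particleUnion (A : Set 𝓕) (μ : Measure 𝓕) : Closeds Y :=
  open Classical in
  if μ A < ∞ then Closeds.closure {y | ∃ K ∈ A, 0 < μ {K} ∧ y ∈ (K : Closeds Y)} else ⊥

/-- The intensity measure restricted to `A`, as a measure on the space of all closed sets. -/
def grainMeasure (Λ : Measure 𝓕) (A : Set 𝓕) : Measure (Closeds Y) :=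
  (Λ.restrict A).map Subtype.val

theorem grainMeasure_apply (Λ : Measure 𝓕) (A : Set 𝓕) {C : Set (Closeds Y)}
    (hC : MeasurableSet C) : grainMeasure Λ A C = Λ (A ∩ Subtype.val ⁻¹' C) := by
  rw [grainMeasure, Measure.map_apply measurable_subtype_coe hC,
    Measure.restrict_apply (measurable_subtype_coe hC), Set.inter_comm]

theorem isFiniteMeasure_grainMeasure {Λ : Measure 𝓕} {A : Set 𝓕} (hA : Λ A < ∞) :
    IsFiniteMeasure (grainMeasure Λ A) :=
  ⟨by rw [grainMeasure_apply Λ A MeasurableSet.univ]; simpa using hA⟩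

theorem ae_mem_grainMeasure (Λ : Measure 𝓕) (A : Set 𝓕) {S : Set (Closeds Y)}
    (hS : MeasurableSet S) (h𝓕 : 𝓕 ⊆ S) : ∀ᵐ K ∂(grainMeasure Λ A), K ∈ S :=
  (ae_map_iff (p := (· ∈ S)) measurable_subtype_coe.aemeasurable hS).2
    (Filter.Eventually.of_forall fun K => h𝓕 K.2)

theorem IsCountingMeasure.one_le {X : Type*} [MeasurableSpace X] {μ : Measure X}
    (hμ : IsCountingMeasure μ) {A : Set X} (hA : MeasurableSet A) (h : 0 < μ A) : 1 ≤ μ A := by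
  obtain ⟨n, hn⟩ := hμ.2 A hA
  rw [hn] at h ⊢
  have : n ≠ 0 := by rintro rfl; simp at h
  exact_mod_cast Order.one_le_iff_ne_zero.2 this

/-- Every atom has mass at least 1, so a set of finite mass contains only finitely many. -/
theorem IsCountingMeasure.finite_atoms {X : Type*} [MeasurableSpace X]
    [MeasurableSingletonClass X] {μ : Measure X} (hμ : IsCountingMeasure μ) {A : Set X}
    (hA : μ A < ∞) : {x | x ∈ A ∧ 0 < μ {x}}.Finite := by
  have h := Measure.finite_const_le_meas_of_disjoint_iUnion (μ.restrict A) one_pos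
    (As := fun x : X => {x}) (fun x => measurableSet_singleton x)
    (fun x y hxy => by simpa using hxy) (by rw [Set.iUnion_of_singleton]; simpa using hA.ne)
  refine h.subset ?_
  rintro x ⟨hxA, hx⟩
  change 1 ≤ μ.restrict A {x}
  rw [Measure.restrict_apply (measurableSet_singleton x), Set.singleton_inter_of_mem hxA]
  exact hμ.one_le (measurableSet_singleton x) hx

variable {Ω : Type*} [MeasurableSpace Ω] {P : Measure Ω} {Λ : Measure 𝓕} {η : Ω → Measure 𝓕}

theorem IsPoissonProcess.measurable_eval (hη : IsPoissonProcess P Λ η) {A : Set 𝓕}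
    (hA : MeasurableSet A) : Measurable fun ω => η ω A :=
  (Measure.measurable_coe hA).comp hη.measurable

theorem poissonLaw_singleton_zero {c : ℝ≥0∞} (hc : c ≠ ∞) :
    poissonLaw c {0} = ENNReal.ofReal (Real.exp (-c.toReal)) := by
  rw [poissonLaw, if_neg hc, Measure.map_apply (measurable_of_countable _)
    (measurableSet_singleton _)]
  have : (fun n : ℕ => (n : ℝ≥0∞)) ⁻¹' {0} = {0} := by ext; simp
  rw [this, poissonMeasure_singleton]
  simp [ENNReal.toReal]

theorem poissonLaw_singleton_top {c : ℝ≥0∞} (hc : c ≠ ∞) : poissonLaw c {∞} = 0 := by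
  rw [poissonLaw, if_neg hc, Measure.map_apply (measurable_of_countable _)
    (measurableSet_singleton _)]
  have : (fun n : ℕ => (n : ℝ≥0∞)) ⁻¹' {∞} = ∅ := by ext; simp
  rw [this, measure_empty]

theorem IsPoissonProcess.ae_lt_top (hη : IsPoissonProcess P Λ η) {A : Set 𝓕}
    (hA : MeasurableSet A) (hΛ : Λ A < ∞) : ∀ᵐ ω ∂P, η ω A < ∞ := by
  have h := poissonLaw_singleton_top hΛ.ne
  rw [← hη.law A hA, Measure.map_apply (hη.measurable_eval hA) (measurableSet_singleton _)] at h
  rw [ae_iff]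
  convert h using 2
  ext ω
  simp

theorem IsPoissonProcess.ae_forall_lt_top {B : ℕ → Set 𝓕} (hη : IsPoissonProcess P Λ η)
    (hB_meas : ∀ n, MeasurableSet (B n)) (hB_fin : ∀ n, Λ (B n) < ∞) :
    ∀ᵐ ω ∂P, ∀ n, η ω (B n) < ∞ :=
  ae_all_iff.2 fun n => hη.ae_lt_top (hB_meas n) (hB_fin n)

variable [T2Space Y] [LocallyCompactSpace Y] [SecondCountableTopology Y]

/-- Finitely many closed sets have a closed union, so the closure in `particleUnion` adds no points.
-/
theorem particleUnion_eq_sup {μ : Measure 𝓕} (hμ : IsCountingMeasure μ) {A : Set 𝓕}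
    (hA : μ A < ∞) :
    particleUnion A μ = (hμ.finite_atoms hA).toFinset.sup fun K => (K : Closeds Y) := by
  have h : {y | ∃ K ∈ A, 0 < μ {K} ∧ y ∈ (K : Closeds Y)} =
      (((hμ.finite_atoms hA).toFinset.sup fun K => (K : Closeds Y) : Closeds Y) : Set Y) := by
    rw [Closeds.coe_finset_sup]
    ext y
    simp [Finset.sup_eq_iSup, and_assoc]
  rw [particleUnion, if_pos hA, h]
  exact SetLike.coe_injective (Closeds.isClosed _).closure_eq

theorem coe_particleUnion {μ : Measure 𝓕} (hμ : IsCountingMeasure μ) {A : Set 𝓕}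
    (hA : μ A < ∞) :
    (particleUnion A μ : Set Y) = {y | ∃ K ∈ A, 0 < μ {K} ∧ y ∈ (K : Closeds Y)} := by
  rw [particleUnion_eq_sup hμ hA, Closeds.coe_finset_sup]
  ext y
  simp [Finset.sup_eq_iSup, and_assoc]

theorem particleUnion_mem {μ : Measure 𝓕} (hμ : IsCountingMeasure μ) (A : Set 𝓕)
    {S : Set (Closeds Y)} (hbot : ⊥ ∈ S) (hsup : ∀ K ∈ S, ∀ L ∈ S, K ⊔ L ∈ S) (h𝓕 : 𝓕 ⊆ S) :
    particleUnion A μ ∈ S := by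
  by_cases hA : μ A < ∞
  · rw [particleUnion_eq_sup hμ hA]
    exact Finset.sup_induction (p := (· ∈ S)) hbot hsup fun K _ => h𝓕 K.2
  · rw [particleUnion, if_neg hA]
    exact hbot

/-- Positive mass on the grains hitting C must be carried by an actual atom, by
`exists_singleton_pos_of_integer_valued`. This expresses the union through evaluations of μ, whence
its measurability and its law. -/
theorem particleUnion_mem_missSet {μ : Measure 𝓕} (hμ : IsCountingMeasure μ) {A : Set 𝓕}
    (hAm : MeasurableSet A) (hA : μ A < ∞) {C : Set Y} (hC : IsCompact C) :
    particleUnion A μ ∈ missSet C ↔ μ (A ∩ Subtype.val ⁻¹' (missSet C)ᶜ) = 0 := by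
  have hm : MeasurableSet (A ∩ Subtype.val ⁻¹' (missSet C)ᶜ) :=
    hAm.inter (measurable_subtype_coe (measurableSet_missSet hC).compl)
  rw [mem_missSet, coe_particleUnion hμ hA]
  constructor
  · intro h
    by_contra h0
    obtain ⟨K, hK, hpos⟩ := exists_singleton_pos_of_integer_valued hm (fun D hD hDA => by
      obtain ⟨n, hn⟩ := hμ.2 D hD
      have : μ D < ∞ := (measure_mono (hDA.trans Set.inter_subset_left)).trans_lt hA
      rw [hn] at this
      lift n to ℕ using (by rintro rfl; simp at this)
      exact ⟨n, by simpa using hn⟩) (pos_iff_ne_zero.2 h0)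
    obtain ⟨y, hyK, hyC⟩ := Set.nonempty_iff_ne_empty.2 hK.2
    exact Set.eq_empty_iff_forall_notMem.1 h y ⟨⟨K, hK.1, hpos, hyK⟩, hyC⟩
  · intro h
    refine Set.eq_empty_iff_forall_notMem.2 ?_
    rintro y ⟨⟨K, hKA, hpos, hyK⟩, hyC⟩
    refine hpos.ne' (measure_mono_null ?_ h)
    rw [Set.singleton_subset_iff]
    exact ⟨hKA, fun hmiss => Set.eq_empty_iff_forall_notMem.1 hmiss y ⟨hyK, hyC⟩⟩

theorem IsPoissonProcess.measurable_particleUnion (hη : IsPoissonProcess P Λ η) {A : Set 𝓕}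
    (hA : MeasurableSet A) : Measurable fun ω => particleUnion A (η ω) := by
  refine measurable_of_missSet fun C hC => ?_
  have hm : MeasurableSet (A ∩ Subtype.val ⁻¹' (missSet C)ᶜ) :=
    hA.inter (measurable_subtype_coe (measurableSet_missSet hC).compl)
  have : (fun ω => particleUnion A (η ω)) ⁻¹' missSet C =
      {ω | η ω A < ∞}ᶜ ∪ {ω | η ω (A ∩ Subtype.val ⁻¹' (missSet C)ᶜ) = 0} := by
    ext ω
    by_cases h : η ω A < ∞
    · simp only [Set.mem_preimage, particleUnion_mem_missSet (hη.counting ω) hA h hC]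
      simp [h]
    · simp only [Set.mem_preimage, particleUnion, if_neg h, bot_mem_missSet]
      simp [h]
  rw [this]
  exact (measurableSet_lt (hη.measurable_eval hA) measurable_const).compl.union
    (hη.measurable_eval hm (measurableSet_singleton 0))

/-- Both laws have the void probabilities e^{-Λ(grains in A hitting C)}, and these determine them.
-/
theorem IsPoissonProcess.map_particleUnion [IsProbabilityMeasure P]
    (hη : IsPoissonProcess P Λ η) {A : Set 𝓕}
    (hA : MeasurableSet A) (hΛ : Λ A < ∞) :
    P.map (fun ω => particleUnion A (η ω)) = poissonUnion (grainMeasure Λ A) 1 := by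
  have := isFiniteMeasure_grainMeasure hΛ
  have hZ := hη.measurable_particleUnion hA
  have := Measure.isProbabilityMeasure_map hZ.aemeasurable (μ := P)
  refine measure_ext_of_missSet fun C hC => ?_
  have hm : MeasurableSet (A ∩ Subtype.val ⁻¹' (missSet C)ᶜ) :=
    hA.inter (measurable_subtype_coe (measurableSet_missSet hC).compl)
  have hfin : Λ (A ∩ Subtype.val ⁻¹' (missSet C)ᶜ) ≠ ∞ :=
    ((measure_mono Set.inter_subset_left).trans_lt hΛ).ne
  rw [poissonUnion_missSet _ zero_le_one hC, one_mul, Measure.real,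
    grainMeasure_apply Λ A (measurableSet_missSet hC).compl, ← poissonLaw_singleton_zero hfin,
    ← hη.law _ hm, Measure.map_apply hZ (measurableSet_missSet hC),
    Measure.map_apply (hη.measurable_eval hm) (measurableSet_singleton _)]
  refine measure_congr ?_
  filter_upwards [hη.ae_lt_top hA hΛ] with ω hω
  exact propext (particleUnion_mem_missSet (hη.counting ω) hA hω hC)

theorem IsPoissonProcess.lintegral_particleUnion [IsProbabilityMeasure P]
    (hη : IsPoissonProcess P Λ η) {A : Set 𝓕}
    (hA : MeasurableSet A) (hΛ : Λ A < ∞) {f : Closeds Y → ℝ≥0∞} (hf : Measurable f) :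
    ∫⁻ ω, f (particleUnion A (η ω)) ∂P = ∫⁻ Z, f Z ∂(poissonUnion (grainMeasure Λ A) 1) := by
  rw [← hη.map_particleUnion hA hΛ, lintegral_map hf (hη.measurable_particleUnion hA)]

theorem grainUnion_eq_iUnion {B : ℕ → Set 𝓕} (hB : ⋃ n, B n = Set.univ) {μ : Measure 𝓕}
    (hμ : IsCountingMeasure μ) (hfin : ∀ n, μ (B n) < ∞) :
    grainUnion B μ = ⋃ n, (particleUnion (B n) μ : Set Y) := by
  ext y
  simp only [grainUnion, Set.mem_ofPred_eq, Set.mem_iUnion, coe_particleUnion hμ (hfin _)]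
  constructor
  · rintro ⟨-, K, hK, hy⟩
    obtain ⟨n, hn⟩ := Set.mem_iUnion.1 (hB ▸ Set.mem_univ K)
    exact ⟨n, K, hn, hK, hy⟩
  · rintro ⟨n, K, -, hK, hy⟩
    exact ⟨hfin, K, hK, hy⟩

theorem particleUnion_mono {B : ℕ → Set 𝓕} (hB : Monotone B) {μ : Measure 𝓕}
    (hμ : IsCountingMeasure μ) (hfin : ∀ n, μ (B n) < ∞) :
    Monotone fun n => (particleUnion (B n) μ : Set Y) := by
  intro m n hmn
  simp only [coe_particleUnion hμ (hfin _)]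
  rintro y ⟨K, hK, h⟩
  exact ⟨K, hB hmn hK, h⟩

/-- The empty set is added because a Poisson union may contain no grain at all, while ∅ need not
belong to `𝓕`. Its content is 0, so measurability is a question on `𝓕` only. -/
theorem isGrainClass_insert_bot [MeasurableSpace Y] {ρ : Measure Y} (h𝓕 : MeasurableSet 𝓕)
    (h𝓕_union : ∀ K ∈ 𝓕, ∀ L ∈ 𝓕, K ⊔ L ∈ 𝓕) (hρ_fin : ∀ K : 𝓕, content ρ K < ∞)
    (hρ_meas : Measurable (fun K : 𝓕 => content ρ K)) : IsGrainClass ρ (insert ⊥ 𝓕) where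
  measurableSet := h𝓕.insert ⊥
  bot_mem := Set.mem_insert _ _
  sup_mem := by
    rintro K (rfl | hK) L (rfl | hL)
    · simp
    · simp [hL]
    · simp [hK]
    · exact Or.inr (h𝓕_union K hK L hL)
  lt_top := by
    rintro K (rfl | hK)
    · simp
    · exact hρ_fin ⟨K, hK⟩
  measurable_content := by
    refine measurable_of_restrict_of_restrict_compl h𝓕 ?_ ?_
    · convert hρ_meas with K
      exact grainContent_of_mem (Or.inr K.2)
    · convert measurable_const (a := (0 : ℝ≥0∞)) with K
      by_cases hK : (K : Closeds Y) = ⊥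
      · rw [Set.domRestrict_apply, hK, grainContent_bot]
      · have : (K : Closeds Y) ∉ insert ⊥ 𝓕 := by
          rintro (h | h)
          exacts [hK h, K.2 h]
        simp [grainContent, Set.indicator_of_notMem this]

end Particles

/-! ### The generalized inverse and Young's inequality -/

theorem genInv_mono (g : ℝ≥0 → ℝ≥0∞) : Monotone (genInv g) := by
  intro u v huv
  refine sInf_le_sInf (Set.image_mono fun s hs => ?_)
  exact huv.trans hs

theorem genInv_le {g : ℝ≥0 → ℝ≥0∞} {u : ℝ≥0∞} {s : ℝ≥0} (h : u ≤ g s) : genInv g u ≤ s :=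
  sInf_le ⟨s, h, rfl⟩

/-- Young's inequality: inside the rectangle (0,r] × (0,s), the region v < g^{-1}(u) and the region
u ≤ g(v) are disjoint, because g(v) ≥ u forces g^{-1}(u) ≤ v. -/
theorem lintegral_genInv_add_le {g : ℝ≥0 → ℝ≥0∞} (hg : Monotone g) {r : ℝ} (hr : 0 < r)
    {s : ℝ≥0} (hs : genInv g (ENNReal.ofReal r) = s) :
    (∫⁻ u in Set.Ioc (0 : ℝ) r, genInv g (ENNReal.ofReal u)) +
      ∫⁻ v in Set.Ioc (0 : ℝ) s, g v.toNNReal ≤ ENNReal.ofReal (s * r) := by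
  have hmeas : Measurable fun u : ℝ => genInv g (ENNReal.ofReal u) :=
    (genInv_mono g).measurable.comp ENNReal.measurable_ofReal
  have hgm : Measurable fun v : ℝ => g v.toNNReal :=
    hg.measurable.comp measurable_real_toNNReal
  let T : Set (ℝ × ℝ) := {p | ENNReal.ofReal p.2 < genInv g (ENNReal.ofReal p.1)}
  have hT : MeasurableSet T :=
    measurableSet_lt (ENNReal.measurable_ofReal.comp measurable_snd) (hmeas.comp measurable_fst)
  have hTm : Measurable (T.indicator fun _ => (1 : ℝ≥0∞)) := measurable_const.indicator hT
  have h1 : ∀ u ∈ Set.Ioc (0 : ℝ) r, genInv g (ENNReal.ofReal u) ≤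
      ∫⁻ v in Set.Ioo (0 : ℝ) s, T.indicator (fun _ => (1 : ℝ≥0∞)) (u, v) := by
    intro u hu
    have hle : genInv g (ENNReal.ofReal u) ≤ s :=
      hs ▸ genInv_mono g (ENNReal.ofReal_le_ofReal hu.2)
    obtain ⟨t, ht⟩ := WithTop.ne_top_iff_exists.1 (ne_top_of_le_ne_top ENNReal.coe_ne_top hle)
    change (t : ℝ≥0∞) = _ at ht
    have hts : t ≤ s := by rw [← ht] at hle; exact_mod_cast hle
    calc genInv g (ENNReal.ofReal u) = ∫⁻ v in Set.Ioo (0 : ℝ) t, 1 := by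
          simp [← ht, Real.volume_Ioo]
      _ ≤ ∫⁻ v in Set.Ioo (0 : ℝ) t, T.indicator (fun _ => (1 : ℝ≥0∞)) (u, v) := by
          refine setLIntegral_mono (hTm.comp measurable_prodMk_left) fun v hv => ?_
          have : (u, v) ∈ T := by
            change ENNReal.ofReal v < genInv g (ENNReal.ofReal u)
            rw [← ht, ← ENNReal.ofReal_coe_nnreal]
            exact (ENNReal.ofReal_lt_ofReal_iff (hv.1.trans hv.2)).2 hv.2
          simp [this]
      _ ≤ _ := lintegral_mono_set (Set.Ioo_subset_Ioo_right (by exact_mod_cast hts))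
  -- For v < s the slice of T at height v lies in (g(v), r], so its length and g(v) together are at
  -- most r.
  have h2 : ∀ v ∈ Set.Ioo (0 : ℝ) s,
      (∫⁻ u in Set.Ioc (0 : ℝ) r, T.indicator (fun _ => (1 : ℝ≥0∞)) (u, v)) + g v.toNNReal ≤
        ENNReal.ofReal r := by
    intro v hv
    have hlt : ∀ u : ℝ, (u, v) ∈ T → g v.toNNReal < ENNReal.ofReal u := by
      intro u hu
      by_contra! hcon
      exact absurd (genInv_le hcon) (not_le.2 hu)
    have hvr : g v.toNNReal < ENNReal.ofReal r := by
      refine hlt r ?_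
      change ENNReal.ofReal v < genInv g (ENNReal.ofReal r)
      rw [hs, ← ENNReal.ofReal_coe_nnreal]
      exact (ENNReal.ofReal_lt_ofReal_iff (hv.1.trans hv.2)).2 hv.2
    obtain ⟨c, hc⟩ := WithTop.ne_top_iff_exists.1 hvr.ne_top
    change (c : ℝ≥0∞) = _ at hc
    have hcr : (c : ℝ) ≤ r := by
      rw [← hc, ← ENNReal.ofReal_coe_nnreal, ENNReal.ofReal_lt_ofReal_iff hr] at hvr
      exact hvr.le
    have h3 : (∫⁻ u in Set.Ioc (0 : ℝ) r, T.indicator (fun _ => (1 : ℝ≥0∞)) (u, v)) ≤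
        ENNReal.ofReal (r - c) := by
      calc _ ≤ ∫⁻ u in Set.Ioc (0 : ℝ) r, (Set.Ioc (c : ℝ) r).indicator (fun _ => 1) u := by
            refine setLIntegral_mono (measurable_const.indicator measurableSet_Ioc) fun u hu => ?_
            by_cases huT : (u, v) ∈ T
            · have := hlt u huT
              rw [← hc, ← ENNReal.ofReal_coe_nnreal, ENNReal.ofReal_lt_ofReal_iff hu.1] at this
              have hm : u ∈ Set.Ioc (c : ℝ) r := ⟨this, hu.2⟩
              simp [huT, hm]
            · simp [huT]
        _ ≤ ∫⁻ u, (Set.Ioc (c : ℝ) r).indicator (fun _ => 1) u := setLIntegral_le_lintegral _ _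
        _ = _ := by simp [lintegral_indicator measurableSet_Ioc]
    calc _ ≤ ENNReal.ofReal (r - c) + ENNReal.ofReal c := by
          rw [← hc, ENNReal.ofReal_coe_nnreal]
          gcongr
      _ = _ := by
          rw [← ENNReal.ofReal_add (sub_nonneg.2 hcr) NNReal.zero_le_coe]
          simp
  -- The endpoint v = s is dropped because g may jump above r there.
  have hIoo : ∫⁻ v in Set.Ioc (0 : ℝ) s, g v.toNNReal =
      ∫⁻ v in Set.Ioo (0 : ℝ) s, g v.toNNReal :=
    setLIntegral_congr Ioo_ae_eq_Ioc.symm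
  calc _ ≤ (∫⁻ u in Set.Ioc (0 : ℝ) r, ∫⁻ v in Set.Ioo (0 : ℝ) s,
            T.indicator (fun _ => (1 : ℝ≥0∞)) (u, v)) +
          ∫⁻ v in Set.Ioo (0 : ℝ) s, g v.toNNReal := by
        rw [hIoo]
        gcongr 1
        exact setLIntegral_mono hTm.lintegral_prod_right' h1
    _ = ∫⁻ v in Set.Ioo (0 : ℝ) s, ((∫⁻ u in Set.Ioc (0 : ℝ) r,
            T.indicator (fun _ => (1 : ℝ≥0∞)) (u, v)) + g v.toNNReal) := by
        rw [lintegral_lintegral_swap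
          (f := fun u v => T.indicator (fun _ => (1 : ℝ≥0∞)) (u, v)) hTm.aemeasurable,
          lintegral_add_right _ hgm]
    _ ≤ ∫⁻ v in Set.Ioo (0 : ℝ) s, ENNReal.ofReal r := setLIntegral_mono measurable_const h2
    _ = _ := by
        rw [setLIntegral_const, Real.volume_Ioo, sub_zero, mul_comm,
          ← ENNReal.ofReal_mul NNReal.zero_le_coe]

/-! ### Continuity of `τ` -/

theorem measurable_tau : Measurable tau := by
  unfold tau
  refine Measurable.ite (measurableSet_singleton 0) measurable_const
    (Measurable.ite (measurableSet_singleton ∞) measurable_const ?_)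
  fun_prop

theorem tau_le_one (z : ℝ≥0∞) : tau z ≤ 1 := by
  by_cases hz : z = ∞
  · simp [tau, hz]
  · rw [← lintegral_exp_neg_mul_eq_tau hz]
    calc _ ≤ ∫⁻ a in Set.Ioc (0 : ℝ) 1, 1 := by
          refine setLIntegral_mono measurable_const fun a ha => ?_
          rw [ENNReal.ofReal_le_one, Real.exp_le_one_iff, neg_nonpos]
          exact mul_nonneg ha.1.le ENNReal.toReal_nonneg
      _ = 1 := by simp

theorem tau_le_inv (z : ℝ≥0∞) : tau z ≤ z⁻¹ := by
  by_cases h0 : z = 0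
  · simp [h0]
  by_cases hz : z = ∞
  · simp [tau, hz]
  have hpos : 0 < z.toReal := ENNReal.toReal_pos h0 hz
  simp only [tau, h0, hz, if_false]
  rw [← ENNReal.ofReal_toReal hz, ← ENNReal.ofReal_inv_of_pos hpos, ENNReal.toReal_ofReal hpos.le]
  refine ENNReal.ofReal_le_ofReal ?_
  rw [inv_eq_one_div]
  gcongr
  linarith [Real.exp_pos (-z.toReal)]

/-- For a finite limit use dominated convergence in the integral representation; for z = ∞ use τ(z)
≤ 1/z. The infinite limit occurs at points covered with infinite intensity. -/
theorem tendsto_tau {x : ℕ → ℝ≥0∞} {z : ℝ≥0∞} (hx : Filter.Tendsto x Filter.atTop (nhds z))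
    (hfin : ∀ n, x n ≠ ∞) :
    Filter.Tendsto (fun n => tau (x n)) Filter.atTop (nhds (tau z)) := by
  by_cases hz : z = ∞
  · subst hz
    have h0 : tau ∞ = 0 := by simp [tau]
    rw [h0]
    refine tendsto_of_tendsto_of_tendsto_of_le_of_le tendsto_const_nhds ?_
      (fun n => zero_le) (fun n => tau_le_inv (x n))
    simpa using tendsto_inv_iff.2 hx
  · simp only [← lintegral_exp_neg_mul_eq_tau hz, ← lintegral_exp_neg_mul_eq_tau (hfin _)]
    have hx' := (ENNReal.tendsto_toReal hz).comp hx
    refine tendsto_lintegral_of_dominated_convergence (fun _ => 1) (fun n => by fun_prop) ?_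
      (by simp) ?_
    · intro n
      refine ae_restrict_of_forall_mem measurableSet_Ioc fun a ha => ?_
      rw [ENNReal.ofReal_le_one, Real.exp_le_one_iff, neg_nonpos]
      exact mul_nonneg ha.1.le ENNReal.toReal_nonneg
    · refine Filter.Eventually.of_forall fun a => ?_
      refine (ENNReal.continuous_ofReal.tendsto _).comp ((Real.continuous_exp.tendsto _).comp ?_)
      exact (hx'.const_mul a).neg

/-! ### The functions `ρ*` and `h` as limits over the exhausting sequence -/

/-- Integrating the integrand of h in its parameter gives the exponential excess; this is how ∫_0^s
h enters. -/
theorem lintegral_mul_exp_sub_one {k s : ℝ} (hk : 0 ≤ k) (hs : 0 ≤ s) :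
    ∫⁻ v in Set.Ioc (0 : ℝ) s, ENNReal.ofReal (k * (Real.exp (v * k) - 1)) =
      ENNReal.ofReal (Real.exp (s * k) - 1 - s * k) := by
  have hcont : Continuous fun v : ℝ => k * (Real.exp (v * k) - 1) := by fun_prop
  rw [← ofReal_integral_eq_lintegral_ofReal hcont.integrableOn_Ioc,
    ← intervalIntegral.integral_of_le hs]
  · have hd : ∀ x ∈ Set.uIcc (0 : ℝ) s,
        HasDerivAt (fun v : ℝ => Real.exp (v * k) - v * k) (k * (Real.exp (x * k) - 1)) x := by
      intro x _
      have h1 : HasDerivAt (fun v : ℝ => v * k) (1 * k) x := (hasDerivAt_id x).mul_const k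
      refine (h1.exp.sub h1).congr_deriv ?_
      ring
    rw [intervalIntegral.integral_eq_sub_of_hasDerivAt hd (hcont.intervalIntegrable _ _)]
    congr 1
    simp only [zero_mul, Real.exp_zero]
    ring
  · refine ae_restrict_of_forall_mem measurableSet_Ioc fun v hv => ?_
    refine mul_nonneg hk (sub_nonneg.2 (Real.one_le_exp ?_))
    exact mul_nonneg hv.1.le hk

/-- Multiplying 1 - t ≤ e^{-t} by e^t, with t = sx, gives e^t - 1 ≤ t e^t. The bound is linear in x,
so for grains of content at most 1 integrability of ρ suffices. -/
theorem exp_sub_one_sub_le {s x : ℝ} (hs : 0 ≤ s) (hx : 0 ≤ x) (hx1 : x ≤ 1) :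
    Real.exp (s * x) - 1 - s * x ≤ s * Real.exp s * x := by
  have h0 : 0 ≤ s * x := mul_nonneg hs hx
  have h1 := Real.add_one_le_exp (-(s * x))
  have h2 : Real.exp (s * x) * Real.exp (-(s * x)) = 1 := by rw [← Real.exp_add]; simp
  have h3 : Real.exp (s * x) ≤ Real.exp s :=
    Real.exp_le_exp.2 (mul_le_of_le_one_right hs hx1)
  have h4 : Real.exp (s * x) * (-(s * x) + 1) ≤ 1 :=
    (mul_le_mul_of_nonneg_left h1 (Real.exp_nonneg _)).trans h2.le
  have h5 : s * x * Real.exp (s * x) ≤ s * x * Real.exp s := mul_le_mul_of_nonneg_left h3 h0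
  nlinarith

section Limits

variable {Y : Type*} [TopologicalSpace Y] [MeasurableSpace Y] {𝓕 : Set (Closeds Y)}
  {ρ : Measure Y} {Λ : Measure 𝓕}

theorem rhoStar_le (K : 𝓕) : rhoStar ρ Λ K ≤ content ρ K := by
  calc _ ≤ ∫⁻ y in ((K : Closeds Y) : Set Y), 1 ∂ρ := lintegral_mono fun y => tau_le_one _
    _ = _ := by simp [content]

theorem rhoStarOn_le (Λ : Measure (Closeds Y)) (K : Closeds Y) :
    rhoStarOn ρ Λ K ≤ ρ (K : Set Y) := by
  calc _ ≤ ∫⁻ y in (K : Set Y), 1 ∂ρ := lintegral_mono fun y => tau_le_one _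
    _ = _ := by simp

theorem lintegral_exp_content_lt_top {s : ℝ} (hs : ENNReal.ofReal s < sZero ρ Λ) :
    ∫⁻ K in {K : 𝓕 | 1 < content ρ K}, ENNReal.ofReal (Real.exp (s * (content ρ K).toReal)) ∂Λ
      < ∞ := by
  obtain ⟨_, ⟨t, ⟨-, ht⟩, rfl⟩, hst⟩ := lt_sSup_iff.1 hs
  refine lt_of_le_of_lt (lintegral_mono fun K => ENNReal.ofReal_le_ofReal ?_) ht
  refine Real.exp_le_exp.2 (mul_le_mul_of_nonneg_right ?_ ENNReal.toReal_nonneg)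
  change ENNReal.ofReal s < (t : ℝ≥0∞) at hst
  rw [← ENNReal.ofReal_coe_nnreal] at hst
  exact (ENNReal.ofReal_le_ofReal_iff NNReal.zero_le_coe).1 hst.le

theorem grainContent_coe (K : 𝓕) :
    grainContent ρ (insert ⊥ 𝓕) K = content ρ K := grainContent_of_mem (Or.inr K.2)

theorem measurable_content_coe (hS : IsGrainClass ρ (insert ⊥ 𝓕)) :
    Measurable fun K : 𝓕 => content ρ K := by
  have := hS.measurable_content.comp (measurable_subtype_coe (p := (· ∈ 𝓕)))
  simpa only [Function.comp_def, grainContent_coe] using this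

/-- The integral of `h` in terms of the exponential excess. -/
theorem lintegral_hFun [SigmaFinite Λ] (hS : IsGrainClass ρ (insert ⊥ 𝓕))
    (hρs : Measurable (rhoStar ρ Λ)) {s : ℝ} (hs : 0 ≤ s) :
    ∫⁻ v in Set.Ioc (0 : ℝ) s, hFun ρ Λ v.toNNReal =
      ∫⁻ K : 𝓕, expExcess ρ (insert ⊥ 𝓕) s K * rhoStar ρ Λ K ∂Λ := by
  have hc := measurable_content_coe hS
  have hd : Measurable fun K : 𝓕 => rhoStar ρ Λ K / content ρ K := hρs.div hc
  have h1 : ∀ v ∈ Set.Ioc (0 : ℝ) s, hFun ρ Λ v.toNNReal =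
      ∫⁻ K : 𝓕, (rhoStar ρ Λ K / content ρ K) *
        ENNReal.ofReal ((content ρ K).toReal * (Real.exp (v * (content ρ K).toReal) - 1)) ∂Λ := by
    intro v hv
    rw [hFun, nuStar, lintegral_map (by fun_prop) hc.ennreal_toNNReal,
      lintegral_withDensity_eq_lintegral_mul _ hd (by fun_prop)]
    refine lintegral_congr fun K => ?_
    simp [Real.coe_toNNReal v hv.1.le, ENNReal.toReal]
  rw [setLIntegral_congr_fun measurableSet_Ioc h1, lintegral_lintegral_swap]
  · refine lintegral_congr fun K => ?_
    rw [lintegral_const_mul _ (by fun_prop),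
      lintegral_mul_exp_sub_one ENNReal.toReal_nonneg hs, expExcess, grainContent_coe]
    simp only [div_eq_mul_inv]
    ring
  · refine Measurable.aemeasurable ?_
    unfold Function.uncurry
    have h2 : Measurable fun p : ℝ × 𝓕 => rhoStar ρ Λ p.2 / content ρ p.2 :=
      hd.comp measurable_snd
    have h3 : Measurable fun p : ℝ × 𝓕 => content ρ p.2 := hc.comp measurable_snd
    fun_prop

/-- An integrable majorant of `e^{sρ(K)} - 1 - sρ(K)`. -/
theorem exists_majorant (hS : IsGrainClass ρ (insert ⊥ 𝓕))
    (hΛ_int : ∫⁻ K, content ρ K ∂Λ < ∞) {s : ℝ} (hs : 0 ≤ s)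
    (hs₀ : ENNReal.ofReal s < sZero ρ Λ) :
    ∃ b : 𝓕 → ℝ≥0∞, ∫⁻ K, b K ∂Λ ≠ ∞ ∧
      ∀ K : 𝓕, expExcess ρ (insert ⊥ 𝓕) s K * content ρ K ≤ b K := by
  have hc := measurable_content_coe hS
  have hm : MeasurableSet {K : 𝓕 | 1 < content ρ K} := measurableSet_lt measurable_const hc
  -- The first summand handles grains of content at most 1, the second the larger ones, where s < s₀
  -- gives integrability.
  refine ⟨fun K => ENNReal.ofReal (s * Real.exp s) * content ρ K +
    {K : 𝓕 | 1 < content ρ K}.indicator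
      (fun K => ENNReal.ofReal (Real.exp (s * (content ρ K).toReal))) K, ?_, fun K => ?_⟩
  · rw [lintegral_add_left (hc.const_mul _), lintegral_const_mul _ hc, lintegral_indicator hm]
    have := lintegral_exp_content_lt_top hs₀
    finiteness
  · by_cases hK : 1 < content ρ K
    · refine le_trans ?_ le_add_self
      rw [Set.indicator_of_mem (show K ∈ {K : 𝓕 | 1 < content ρ K} from hK), ← grainContent_coe]
      exact expExcess_mul_content_le hs _
    · refine le_trans ?_ le_self_add
      rw [expExcess, grainContent_coe]
      refine (ENNReal.mul_le_of_le_div le_rfl).trans ?_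
      have hfin : content ρ K ≠ ∞ := (hS.lt_top K (Or.inr K.2)).ne
      conv_rhs => rw [← ENNReal.ofReal_toReal hfin]
      rw [← ENNReal.ofReal_mul (by positivity)]
      refine ENNReal.ofReal_le_ofReal (exp_sub_one_sub_le hs ENNReal.toReal_nonneg ?_)
      exact ENNReal.toReal_le_of_le_ofReal zero_le_one (by simpa using not_lt.1 hK)

theorem lintegral_expContent_grainMeasure_ne_top (hS : IsGrainClass ρ (insert ⊥ 𝓕))
    {A : Set 𝓕} (hA : Λ A < ∞) {s : ℝ} (hs : 0 ≤ s) (hs₀ : ENNReal.ofReal s < sZero ρ Λ) :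
    ∫⁻ K, expContent ρ (insert ⊥ 𝓕) s K ∂(grainMeasure Λ A) ≠ ∞ := by
  have hc := measurable_content_coe hS
  have hm : MeasurableSet {K : 𝓕 | 1 < content ρ K} := measurableSet_lt measurable_const hc
  rw [grainMeasure, lintegral_map (hS.measurable_expContent s) measurable_subtype_coe]
  have hle : ∀ K : 𝓕, expContent ρ (insert ⊥ 𝓕) s K ≤ ENNReal.ofReal (Real.exp s) +
      {K : 𝓕 | 1 < content ρ K}.indicator
        (fun K => ENNReal.ofReal (Real.exp (s * (content ρ K).toReal))) K := by
    intro K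
    rw [expContent, grainContent_coe]
    by_cases hK : 1 < content ρ K
    · refine le_trans ?_ le_add_self
      rw [Set.indicator_of_mem (show K ∈ {K : 𝓕 | 1 < content ρ K} from hK)]
    · refine le_trans (ENNReal.ofReal_le_ofReal (Real.exp_le_exp.2 ?_)) le_self_add
      refine mul_le_of_le_one_right hs ?_
      exact ENNReal.toReal_le_of_le_ofReal zero_le_one (by simpa using not_lt.1 hK)
  refine ne_top_of_le_ne_top ?_ (lintegral_mono hle)
  rw [lintegral_add_left measurable_const, lintegral_const, Measure.restrict_apply_univ]
  refine ENNReal.add_ne_top.2 ⟨by finiteness, ne_top_of_le_ne_top ?_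
    (lintegral_mono' Measure.restrict_le_self le_rfl)⟩
  rw [lintegral_indicator hm]
  exact (lintegral_exp_content_lt_top hs₀).ne

variable [T2Space Y] [LocallyCompactSpace Y] [SecondCountableTopology Y] [BorelSpace Y]

theorem tendsto_rhoStarOn {B : ℕ → Set 𝓕} (hB_mono : Monotone B)
    (hB_cover : ⋃ n, B n = Set.univ) (hB_fin : ∀ n, Λ (B n) < ∞) {K : 𝓕}
    (hK : content ρ K < ∞) :
    Filter.Tendsto (fun n => rhoStarOn ρ (grainMeasure Λ (B n)) K) Filter.atTop
      (nhds (rhoStar ρ Λ K)) := by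
  refine tendsto_lintegral_of_dominated_convergence (fun _ => 1) (fun n => ?_) (fun n => ?_)
    (by simpa [content] using hK.ne) (Filter.Eventually.of_forall fun y => ?_)
  · have := isFiniteMeasure_grainMeasure (hB_fin n)
    refine measurable_tau.comp ?_
    convert measurable_measure_prodMk_left (ν := grainMeasure Λ (B n))
      (measurableSet_mem_closeds (Y := Y)) with y
    ext Z
    simp [mem_missSet_singleton]
  · exact Filter.Eventually.of_forall fun y => tau_le_one _
  · have hm : MeasurableSet (missSet ({y} : Set Y))ᶜ :=
      (measurableSet_missSet isCompact_singleton).compl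
    refine tendsto_tau ?_ fun n => ?_
    · have h : {L : 𝓕 | y ∈ (L : Closeds Y)} =
          ⋃ n, (B n ∩ Subtype.val ⁻¹' (missSet ({y} : Set Y))ᶜ) := by
        rw [← Set.iUnion_inter, hB_cover, Set.univ_inter]
        ext L
        simp [mem_missSet_singleton]
      simp only [grainMeasure_apply Λ _ hm]
      rw [h]
      exact tendsto_measure_iUnion_atTop fun m n hmn =>
        Set.inter_subset_inter_left _ (hB_mono hmn)
    · have := isFiniteMeasure_grainMeasure (hB_fin n)
      exact measure_ne_top _ _

theorem measurable_rhoStarOn (hS : IsGrainClass ρ (insert ⊥ 𝓕)) {A : Set 𝓕} (hA : Λ A < ∞) :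
    Measurable fun K : 𝓕 => rhoStarOn ρ (grainMeasure Λ A) K := by
  have := isFiniteMeasure_grainMeasure hA
  have hae := ae_mem_grainMeasure Λ A hS.measurableSet (Set.subset_insert _ _)
  -- With ρ not assumed σ-finite, measurability in K of an integral over K is obtained from that of
  -- the content of Z ∪ K, through the average of `uncovered`.
  have h : (fun K : 𝓕 => rhoStarOn ρ (grainMeasure Λ A) K) = fun K : 𝓕 =>
      ∫⁻ a in Set.Ioc (0 : ℝ) 1, uncovered ρ (insert ⊥ 𝓕) (grainMeasure Λ A) a K := by
    ext K
    rw [hS.lintegral_uncovered hae (Or.inr K.2)]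
  rw [h]
  have hm : Measurable fun K : Closeds Y =>
      ∫⁻ a in Set.Ioc (0 : ℝ) 1, uncovered ρ (insert ⊥ 𝓕) (grainMeasure Λ A) a K :=
    hS.measurable_uncovered.lintegral_prod_left'
  exact hm.comp measurable_subtype_coe

theorem measurable_rhoStar (hS : IsGrainClass ρ (insert ⊥ 𝓕)) {B : ℕ → Set 𝓕}
    (hB_mono : Monotone B)
    (hB_cover : ⋃ n, B n = Set.univ) (hB_fin : ∀ n, Λ (B n) < ∞) :
    Measurable (rhoStar ρ Λ) :=
  measurable_of_tendsto_metrizable (fun n => measurable_rhoStarOn hS (hB_fin n))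
    (tendsto_pi_nhds.2 fun K => tendsto_rhoStarOn hB_mono hB_cover hB_fin
      (hS.lt_top K (Or.inr K.2)))

theorem tendsto_lintegral_expExcess_mul_rhoStarOn (hS : IsGrainClass ρ (insert ⊥ 𝓕))
    (hΛ_int : ∫⁻ K, content ρ K ∂Λ < ∞) {B : ℕ → Set 𝓕} (hB_mono : Monotone B)
    (hB_cover : ⋃ n, B n = Set.univ) (hB_fin : ∀ n, Λ (B n) < ∞) {s : ℝ} (hs : 0 ≤ s)
    (hs₀ : ENNReal.ofReal s < sZero ρ Λ) :
    Filter.Tendsto (fun n => ∫⁻ K : 𝓕, expExcess ρ (insert ⊥ 𝓕) s K *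
        rhoStarOn ρ (grainMeasure Λ (B n)) K ∂Λ) Filter.atTop
      (nhds (∫⁻ K : 𝓕, expExcess ρ (insert ⊥ 𝓕) s K * rhoStar ρ Λ K ∂Λ)) := by
  obtain ⟨b, hb, hbK⟩ := exists_majorant hS hΛ_int hs hs₀
  have he : Measurable fun K : 𝓕 => expExcess ρ (insert ⊥ 𝓕) s K :=
    (hS.measurable_expExcess s).comp measurable_subtype_coe
  refine tendsto_lintegral_of_dominated_convergence b
    (fun n => he.mul (measurable_rhoStarOn hS (hB_fin n)))
    (fun n => Filter.Eventually.of_forall fun K => ?_) hb (Filter.Eventually.of_forall fun K => ?_)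
  · exact (mul_le_mul_right (rhoStarOn_le _ _) _).trans (hbK K)
  · have hlt := hS.lt_top K (Or.inr K.2)
    refine ENNReal.Tendsto.const_mul (tendsto_rhoStarOn hB_mono hB_cover hB_fin hlt) (Or.inr ?_)
    -- The factor must be finite; for content zero it is 0/0 = 0.
    by_cases h0 : content ρ K = 0
    · rw [expExcess, grainContent_coe, h0]
      simp
    · rw [expExcess, grainContent_coe]
      exact ENNReal.div_ne_top ENNReal.ofReal_ne_top h0

end Limits

/-! ### Moments of the content of the Boolean model -/

section Content

variable {Y : Type*} [TopologicalSpace Y] [T2Space Y] [LocallyCompactSpace Y]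
  [SecondCountableTopology Y] [MeasurableSpace Y] {ρ : Measure Y}
  {𝓕 : Set (Closeds Y)} {Λ : Measure 𝓕} {B : ℕ → Set 𝓕}
  {Ω : Type*} [MeasurableSpace Ω] {P : Measure Ω} {η : Ω → Measure 𝓕}

/-- The content of the union of the particles in `A`. -/
def particleContent (ρ : Measure Y) (A : Set 𝓕) (μ : Measure 𝓕) : ℝ≥0∞ :=
  grainContent ρ (insert ⊥ 𝓕) (particleUnion A μ)

/-- The content of the union of all particles, as a supremum over the exhausting sequence. -/
def totalContent (ρ : Measure Y) (B : ℕ → Set 𝓕) (μ : Measure 𝓕) : ℝ≥0∞ :=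
  ⨆ n, particleContent ρ (B n) μ

theorem IsPoissonProcess.measurable_particleContent (hS : IsGrainClass ρ (insert ⊥ 𝓕))
    (hη : IsPoissonProcess P Λ η) {A : Set 𝓕} (hA : MeasurableSet A) :
    Measurable fun ω => particleContent ρ A (η ω) :=
  hS.measurable_content.comp (hη.measurable_particleUnion hA)

theorem IsPoissonProcess.measurable_totalContent (hS : IsGrainClass ρ (insert ⊥ 𝓕))
    (hη : IsPoissonProcess P Λ η) (hB_meas : ∀ n, MeasurableSet (B n)) :
    Measurable fun ω => totalContent ρ B (η ω) :=
  Measurable.iSup fun n => hη.measurable_particleContent hS (hB_meas n)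

theorem particleContent_eq (hS : IsGrainClass ρ (insert ⊥ 𝓕)) {μ : Measure 𝓕}
    (hμ : IsCountingMeasure μ) (A : Set 𝓕) :
    particleContent ρ A μ = ρ (particleUnion A μ : Set Y) :=
  grainContent_of_mem
    (particleUnion_mem hμ A hS.bot_mem hS.sup_mem (Set.subset_insert _ _))

theorem particleContent_mono (hS : IsGrainClass ρ (insert ⊥ 𝓕)) (hB_mono : Monotone B)
    {μ : Measure 𝓕} (hμ : IsCountingMeasure μ) (hfin : ∀ n, μ (B n) < ∞) :
    Monotone fun n => particleContent ρ (B n) μ := by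
  intro m n hmn
  simp only [particleContent_eq hS hμ]
  exact measure_mono (particleUnion_mono hB_mono hμ hfin hmn)

theorem totalContent_eq (hS : IsGrainClass ρ (insert ⊥ 𝓕)) (hB_mono : Monotone B)
    (hB_cover : ⋃ n, B n = Set.univ) {μ : Measure 𝓕} (hμ : IsCountingMeasure μ)
    (hfin : ∀ n, μ (B n) < ∞) : totalContent ρ B μ = ρ (grainUnion B μ) := by
  rw [grainUnion_eq_iUnion hB_cover hμ hfin,
    (particleUnion_mono hB_mono hμ hfin).measure_iUnion, totalContent]
  simp only [particleContent_eq hS hμ]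

variable [IsProbabilityMeasure P]

variable [BorelSpace Y]

theorem IsPoissonProcess.lintegral_totalContent_le (hS : IsGrainClass ρ (insert ⊥ 𝓕))
    (hη : IsPoissonProcess P Λ η) (hB_meas : ∀ n, MeasurableSet (B n)) (hB_mono : Monotone B)
    (hB_fin : ∀ n, Λ (B n) < ∞) (hs₀ : 0 < sZero ρ Λ) :
    ∫⁻ ω, totalContent ρ B (η ω) ∂P ≤ ∫⁻ K, content ρ K ∂Λ := by
  obtain ⟨s, hs0, hs⟩ := ENNReal.lt_iff_exists_nnreal_btwn.1 hs₀
  have hs0' : (0 : ℝ) < s := by exact_mod_cast hs0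
  rw [← ENNReal.ofReal_coe_nnreal] at hs
  unfold totalContent
  rw [lintegral_iSup' (fun n => (hη.measurable_particleContent hS (hB_meas n)).aemeasurable)]
  · refine iSup_le fun n => ?_
    have := isFiniteMeasure_grainMeasure (hB_fin n)
    unfold particleContent
    rw [hη.lintegral_particleUnion (hB_meas n) (hB_fin n) hS.measurable_content]
    refine (hS.lintegral_content_poissonUnion_le
      (ae_mem_grainMeasure Λ (B n) hS.measurableSet (Set.subset_insert _ _)) hs0'
      (lintegral_expContent_grainMeasure_ne_top hS (hB_fin n) hs0'.le hs)).trans ?_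
    rw [grainMeasure, lintegral_map hS.measurable_content measurable_subtype_coe]
    simp only [grainContent_coe]
    exact lintegral_mono' Measure.restrict_le_self le_rfl
  · filter_upwards [hη.ae_forall_lt_top hB_meas hB_fin] with ω hω
    exact particleContent_mono hS hB_mono (hη.counting ω) hω

theorem IsPoissonProcess.lintegral_exp_totalContent_le (hS : IsGrainClass ρ (insert ⊥ 𝓕))
    (hη : IsPoissonProcess P Λ η) (hB_meas : ∀ n, MeasurableSet (B n)) (hB_mono : Monotone B)
    (hB_cover : ⋃ n, B n = Set.univ) (hB_fin : ∀ n, Λ (B n) < ∞)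
    (hΛ_int : ∫⁻ K, content ρ K ∂Λ < ∞) {s : ℝ} (hs : 0 < s)
    (hs₀ : ENNReal.ofReal s < sZero ρ Λ) :
    ∫⁻ ω, ENNReal.ofReal (Real.exp (s * (totalContent ρ B (η ω)).toReal)) ∂P ≤
      ENNReal.ofReal (Real.exp (s * (∫⁻ ω, totalContent ρ B (η ω) ∂P).toReal +
        (∫⁻ K : 𝓕, expExcess ρ (insert ⊥ 𝓕) s K * rhoStar ρ Λ K ∂Λ).toReal)) := by
  set S : Set (Closeds Y) := insert ⊥ 𝓕
  have hmean : ∫⁻ ω, totalContent ρ B (η ω) ∂P ≠ ∞ := ne_top_of_le_ne_top hΛ_int.ne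
    (hη.lintegral_totalContent_le hS hB_meas hB_mono hB_fin (zero_le.trans_lt hs₀))
  obtain ⟨b, hb, hbK⟩ := exists_majorant hS hΛ_int hs.le hs₀
  have hIfin : ∫⁻ K : 𝓕, expExcess ρ S s K * rhoStar ρ Λ K ∂Λ ≠ ∞ :=
    ne_top_of_le_ne_top hb (lintegral_mono fun K =>
      (mul_le_mul_right (rhoStar_le K) _).trans (hbK K))
  have hJfin : ∀ n, ∫⁻ K : 𝓕, expExcess ρ S s K *
      rhoStarOn ρ (grainMeasure Λ (B n)) K ∂Λ ≠ ∞ := fun n =>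
    ne_top_of_le_ne_top hb (lintegral_mono fun K =>
      (mul_le_mul_right (rhoStarOn_le _ _) _).trans (hbK K))
  have hJ := tendsto_lintegral_expExcess_mul_rhoStarOn hS hΛ_int hB_mono hB_cover hB_fin hs.le hs₀
  have htop : ∀ᵐ ω ∂P, totalContent ρ B (η ω) < ∞ :=
    MeasureTheory.ae_lt_top (hη.measurable_totalContent hS hB_meas) hmean
  have hlim : Filter.Tendsto
      (fun n => ∫⁻ ω, expContent ρ S s (particleUnion (B n) (η ω)) ∂P) Filter.atTop
      (nhds (∫⁻ ω, ENNReal.ofReal (Real.exp (s * (totalContent ρ B (η ω)).toReal)) ∂P)) := by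
    refine lintegral_tendsto_of_tendsto_of_monotone (fun n =>
      ((hS.measurable_expContent s).comp
        (hη.measurable_particleUnion (hB_meas n))).aemeasurable) ?_ ?_
    · filter_upwards [hη.ae_forall_lt_top hB_meas hB_fin] with ω hω
      intro m n hmn
      refine ENNReal.ofReal_le_ofReal (Real.exp_le_exp.2 (mul_le_mul_of_nonneg_left ?_ hs.le))
      exact ENNReal.toReal_mono (hS.content_ne_top _)
        (particleContent_mono hS hB_mono (hη.counting ω) hω hmn)
    · filter_upwards [hη.ae_forall_lt_top hB_meas hB_fin, htop] with ω hω hωtop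
      refine (ENNReal.continuous_ofReal.tendsto _).comp ((Real.continuous_exp.tendsto _).comp ?_)
      refine Filter.Tendsto.const_mul s ?_
      exact (ENNReal.tendsto_toReal hωtop.ne).comp
        (tendsto_atTop_iSup (particleContent_mono hS hB_mono (hη.counting ω) hω))
  -- The mean for `B n` is bounded by the full mean at once. The function ρ* for `B n` is not
  -- bounded by its limit, as fewer grains leave more uncovered, so that term is kept and passed to
  -- the limit.
  refine le_of_tendsto_of_tendsto' hlim ((ENNReal.continuous_ofReal.tendsto _).comp
    ((Real.continuous_exp.tendsto _).comp
      (((ENNReal.tendsto_toReal hIfin).comp hJ).const_add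
        (s * (∫⁻ ω, totalContent ρ B (η ω) ∂P).toReal)))) fun n => ?_
  have := isFiniteMeasure_grainMeasure (hB_fin n)
  rw [hη.lintegral_particleUnion (hB_meas n) (hB_fin n) (hS.measurable_expContent s)]
  refine (hS.lintegral_expContent_poissonUnion_le
      (ae_mem_grainMeasure Λ (B n) hS.measurableSet (Set.subset_insert _ _)) hs
      (lintegral_expContent_grainMeasure_ne_top hS (hB_fin n) hs.le hs₀)).trans ?_
  refine ENNReal.ofReal_le_ofReal (Real.exp_le_exp.2 (add_le_add
    (mul_le_mul_of_nonneg_left (ENNReal.toReal_mono hmean ?_) hs.le)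
    (ENNReal.toReal_mono (hJfin n) ?_)))
  · rw [← hη.lintegral_particleUnion (hB_meas n) (hB_fin n) hS.measurable_content]
    exact lintegral_mono fun ω => le_iSup (fun n => particleContent ρ (B n) (η ω)) n
  · rw [grainMeasure]
    refine (lintegral_map_le _ _).trans ?_
    exact lintegral_mono' Measure.restrict_le_self le_rfl

/-- Chernoff bound in terms of the integral of the generalized inverse of `g`. -/
theorem measure_ge_le_exp_neg_genInv {Ω : Type*} [MeasurableSpace Ω] {P : Measure Ω}
    [IsProbabilityMeasure P] {F : Ω → ℝ} (hF : AEMeasurable F P) {m : ℝ}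
    {g : ℝ≥0 → ℝ≥0∞} (hg : Monotone g) {s₀ : ℝ≥0∞}
    (hmgf : ∀ s : ℝ, 0 < s → ENNReal.ofReal s < s₀ →
      ∫⁻ v in Set.Ioc (0 : ℝ) s, g v.toNNReal ≠ ∞ ∧
      ∫⁻ ω, ENNReal.ofReal (Real.exp (s * F ω)) ∂P ≤
        ENNReal.ofReal (Real.exp (s * m + (∫⁻ v in Set.Ioc (0 : ℝ) s, g v.toNNReal).toReal)))
    {r : ℝ} (hr : 0 < r) (hr₀ : ENNReal.ofReal r < leftLimit g s₀) :
    P {ω | r ≤ F ω - m} ≤ EReal.exp (-((∫⁻ u in Set.Ioc (0 : ℝ) r,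
          genInv g (ENNReal.ofReal u) : ℝ≥0∞) : EReal)) := by
  -- Some t < s₀ has g(t) > r, so s = g^{-1}(r) ≤ t is finite and lies in the range of the moment
  -- bound. This s is the exponent used in Markov's inequality.
  obtain ⟨t, ht⟩ := lt_iSup_iff.1 hr₀
  obtain ⟨ht₀, ht⟩ := lt_iSup_iff.1 ht
  have hle : genInv g (ENNReal.ofReal r) ≤ t := genInv_le ht.le
  lift genInv g (ENNReal.ofReal r) to ℝ≥0 using
    ne_top_of_le_ne_top ENNReal.coe_ne_top hle with s hs
  have hyoung := lintegral_genInv_add_le hg hr hs.symm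
  set x := ∫⁻ u in Set.Ioc (0 : ℝ) r, genInv g (ENNReal.ofReal u)
  have hxtop : x ≠ ∞ := ne_top_of_le_ne_top ENNReal.ofReal_ne_top (le_self_add.trans hyoung)
  have hexp : EReal.exp (-(x : EReal)) = ENNReal.ofReal (Real.exp (-x.toReal)) := by
    conv_lhs => rw [← ENNReal.ofReal_toReal hxtop]
    rw [EReal.coe_ennreal_ofReal, max_eq_left ENNReal.toReal_nonneg, ← EReal.coe_neg,
      EReal.exp_coe]
  rw [hexp]
  -- If s = 0, the inverse integrates to zero on (0, r] and the claimed bound is 1.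
  rcases eq_or_lt_of_le (show 0 ≤ s from zero_le) with h0 | hspos
  · have hx0 : x = 0 := by
      have := le_self_add.trans hyoung
      simpa [← h0] using this
    simpa [hx0] using prob_le_one
  have hspos' : (0 : ℝ) < s := hspos
  obtain ⟨hI, hm⟩ := hmgf s hspos' (by
    rw [ENNReal.ofReal_coe_nnreal]; exact hle.trans_lt ht₀)
  set I := ∫⁻ v in Set.Ioc (0 : ℝ) s, g v.toNNReal
  have hxI : x.toReal + I.toReal ≤ s * r := by
    rw [← ENNReal.toReal_add hxtop hI]
    exact ENNReal.toReal_le_of_le_ofReal (by positivity) hyoung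
  have hmarkov := mul_meas_ge_le_lintegral₀ (μ := P)
    (f := fun ω => ENNReal.ofReal (Real.exp (s * F ω))) (by fun_prop)
    (ENNReal.ofReal (Real.exp (s * (m + r))))
  have hset : {ω | r ≤ F ω - m} ⊆ {ω | ENNReal.ofReal (Real.exp (s * (m + r))) ≤
      ENNReal.ofReal (Real.exp (s * F ω))} := by
    intro ω hω
    refine ENNReal.ofReal_le_ofReal (Real.exp_le_exp.2 (mul_le_mul_of_nonneg_left ?_ hspos'.le))
    have : r ≤ F ω - m := hω
    linarith
  have hpos : ENNReal.ofReal (Real.exp (s * (m + r))) ≠ 0 := by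
    simpa using Real.exp_pos _
  refine (measure_mono hset).trans ?_
  rw [← ENNReal.mul_le_mul_iff_right hpos ENNReal.ofReal_ne_top]
  refine hmarkov.trans (hm.trans ?_)
  rw [← ENNReal.ofReal_mul (by positivity), ← Real.exp_add]
  refine ENNReal.ofReal_le_ofReal (Real.exp_le_exp.2 ?_)
  linarith

end Content

end

end BooleanModel

/-! ### The tail bound for the Boolean model. -/

theorem mainTheorem4
    {Y : Type*} [TopologicalSpace Y] [T2Space Y] [LocallyCompactSpace Y]
    [SecondCountableTopology Y] [MeasurableSpace Y] [BorelSpace Y]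
    (ρ : Measure Y)
    (𝓕 : Set (Closeds Y)) (h𝓕 : MeasurableSet 𝓕)
    (h𝓕_union : ∀ K ∈ 𝓕, ∀ L ∈ 𝓕, K ⊔ L ∈ 𝓕)
    (hρ_fin : ∀ K : 𝓕, BooleanModel.content ρ K < ∞)
    (hρ_meas : Measurable (fun K : 𝓕 => BooleanModel.content ρ K))
    (Λ : Measure 𝓕) [SigmaFinite Λ]
    (hΛ_int : ∫⁻ K, BooleanModel.content ρ K ∂Λ < ∞)
    (hs₀ : 0 < BooleanModel.sZero ρ Λ)
    (B : ℕ → Set 𝓕) (hB_meas : ∀ n, MeasurableSet (B n)) (hB_mono : Monotone B)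
    (hB_cover : ⋃ n, B n = Set.univ) (hB_fin : ∀ n, Λ (B n) < ∞)
    {Ω : Type*} [MeasurableSpace Ω] (P : Measure Ω) [IsProbabilityMeasure P]
    (η : Ω → Measure 𝓕) (hη : BooleanModel.IsPoissonProcess P Λ η)
    (F : Ω → ℝ) (hF : ∀ ω, F ω = BooleanModel.coveredContent ρ B (η ω)) :
    Integrable F P ∧
    ∀ r : ℝ, 0 < r →
      ENNReal.ofReal r <
        BooleanModel.leftLimit (BooleanModel.hFun ρ Λ) (BooleanModel.sZero ρ Λ) →
      P {ω | r ≤ F ω - ∫ ω', F ω' ∂P} ≤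
        EReal.exp (-((∫⁻ u in Set.Ioc (0 : ℝ) r,
          BooleanModel.genInv (BooleanModel.hFun ρ Λ) (ENNReal.ofReal u) : ℝ≥0∞) : EReal)) := by
  have hS := BooleanModel.isGrainClass_insert_bot h𝓕 h𝓕_union hρ_fin hρ_meas
  have hmeas := hη.measurable_totalContent hS hB_meas
  have hmean : ∫⁻ ω, BooleanModel.totalContent ρ B (η ω) ∂P ≠ ∞ :=
    ne_top_of_le_ne_top hΛ_int.ne
      (hη.lintegral_totalContent_le hS hB_meas hB_mono hB_fin hs₀)
  -- `F` and the supremum over the exhaustion agree once every `B n` has finitely many particles;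
  -- the convention ∞ ↦ 0 of `toReal` is the one in the definition of F.
  have hFeq : F =ᵐ[P] fun ω => (BooleanModel.totalContent ρ B (η ω)).toReal := by
    filter_upwards [hη.ae_forall_lt_top hB_meas hB_fin] with ω hω
    rw [hF, BooleanModel.coveredContent,
      BooleanModel.totalContent_eq hS hB_mono hB_cover (hη.counting ω) hω]
  have hint : Integrable F P :=
    (integrable_toReal_of_lintegral_ne_top hmeas.aemeasurable hmean).congr hFeq.symm
  refine ⟨hint, fun r hr hr₀ => ?_⟩
  have hEF : ∫ ω, F ω ∂P = (∫⁻ ω, BooleanModel.totalContent ρ B (η ω) ∂P).toReal := by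
    rw [integral_congr_ae hFeq, integral_toReal hmeas.aemeasurable (ae_lt_top hmeas hmean)]
  have hρs := BooleanModel.measurable_rhoStar hS hB_mono hB_cover hB_fin
  refine BooleanModel.measure_ge_le_exp_neg_genInv hint.aemeasurable
    (BooleanModel.hFun_mono ρ Λ) (fun s hs hss₀ => ?_) hr hr₀
  rw [BooleanModel.lintegral_hFun hS hρs hs.le, hEF]
  obtain ⟨b, hb, hbK⟩ := BooleanModel.exists_majorant hS hΛ_int hs.le hss₀
  refine ⟨ne_top_of_le_ne_top hb (lintegral_mono fun K =>
      (mul_le_mul_right (BooleanModel.rhoStar_le K) _).trans (hbK K)), ?_⟩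
  refine le_trans (le_of_eq (lintegral_congr_ae ?_))
    (hη.lintegral_exp_totalContent_le hS hB_meas hB_mono hB_cover hB_fin hΛ_int hs hss₀)
  filter_upwards [hFeq] with ω hω
  rw [hω]
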